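/- Let $\alpha>0$, let $h_\alpha(x)=(1+x^2)^{-\alpha}$ for $x\in\mathbb{R}$, and let $D_\infty=\mathbb{R}\times(0,\infty)$. For Lebesgue measurable $u_0\in L^\infty(\mathbb{R})$, a global solution with initial data $u_0$ is a function $u:D_\infty\to\mathbb{R}$ that is bounded on $\mathbb{R}\times(0,T]$ for every $T>0$, is of class $C^{2,1}(D_\infty)$ (that is, $u,u_x,u_{xx},u_t$ exist and are continuous on $D_\infty$), and satisfies $$u_t-u_{xx}+h_\alpha(x)\,u\,u_x=0\quad\text{on } D_\infty,$$ $$u(x,t)=\int_{-\infty}^{\infty}\frac{u_0(s)}{\sqrt{4\pi t}}\,e^{-\frac{(x-s)^2}{4t}}\,ds+O(\sqrt t)\quad\text{uniformly for } x\in\mathbb{R}\text{ as } t\to0^+ .$$ Then: (i) For every Lebesgue measurable $u_0\in L^\infty(\mathbb{R})$ there exists exactly one global solution $u$ with initial data $u_0$, and $u$ is bounded on all of $D_\infty$. (ii) For all $T,\varepsilon>0$ and $M\ge0$ there exists $\delta>0$ (depending only on $\alpha,T,\varepsilon,M$) such that, for all Lebesgue measurable $u_{01},u_{02}\in L^\infty(\mathbb{R})$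 with $\|u_{01}\|_\infty\le M$ and $\|u_{01}-u_{02}\|_\infty<\delta$, the corresponding global solutions $u_1,u_2$ satisfy $\|(u_1-u_2)(\cdot,t)\|_\infty<\varepsilon$ for all $t\in(0,T]$. -/

import Mathlib

open MeasureTheory Set

noncomputable section

namespace GenBurgers

/-- The coefficient `h_α(x) = 1 / (1 + x²)^α`. -/
def h (α x : ℝ) : ℝ := 1 / (1 + x ^ 2) ^ α

/-- The partial derivative `u_x` of `u : (x, t) ↦ u x t`. -/
def dx (u : ℝ → ℝ → ℝ) (x t : ℝ) : ℝ := deriv (fun y => u y t) x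

/-- The partial derivative `u_t` of `u : (x, t) ↦ u x t`. -/
def dt (u : ℝ → ℝ → ℝ) (x t : ℝ) : ℝ := deriv (fun s => u x s) t

/-- The domain `D_∞ = ℝ × (0, ∞)`. -/
def domain : Set (ℝ × ℝ) := univ ×ˢ Ioi 0

/-- `u ∈ C^{2,1}(D_∞)`: the derivatives `u_x`, `u_xx`, `u_t` exist everywhere on `D_∞`, and
`u`, `u_x`, `u_xx`, `u_t` are (jointly) continuous on `D_∞`. -/
structure IsC21 (u : ℝ → ℝ → ℝ) : Prop where
  diff_x : ∀ x t : ℝ, 0 < t → DifferentiableAt ℝ (fun y => u y t) x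
  diff_xx : ∀ x t : ℝ, 0 < t → DifferentiableAt ℝ (fun y => dx u y t) x
  diff_t : ∀ x t : ℝ, 0 < t → DifferentiableAt ℝ (fun s => u x s) t
  cont : ContinuousOn (fun p : ℝ × ℝ => u p.1 p.2) domain
  cont_x : ContinuousOn (fun p : ℝ × ℝ => dx u p.1 p.2) domain
  cont_xx : ContinuousOn (fun p : ℝ × ℝ => dx (dx u) p.1 p.2) domain
  cont_t : ContinuousOn (fun p : ℝ × ℝ => dt u p.1 p.2) domain

/-- The solution of the heat equation on the line with initial data `u₀`:
`∫ u₀(s) / √(4πt) · exp(-(x - s)² / (4t)) ds`. -/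
def heatFlow (u₀ : ℝ → ℝ) (x t : ℝ) : ℝ :=
  ∫ s, u₀ s / Real.sqrt (4 * Real.pi * t) * Real.exp (-(x - s) ^ 2 / (4 * t))

/-- `u` is a global classical solution of the Cauchy problem with initial data `u₀`.
Only the values of `u` on `ℝ × (0, ∞)` are relevant. -/
structure IsGlobalSolution (α : ℝ) (u₀ : ℝ → ℝ) (u : ℝ → ℝ → ℝ) : Prop where
  /-- `u` is bounded on `ℝ × (0, T]` for every `T` (for a continuous function this is
  the same as being in `L^∞`). -/
  bounded : ∀ T : ℝ, 0 < T → ∃ C : ℝ, ∀ x t : ℝ, 0 < t → t ≤ T → |u x t| ≤ C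
  regular : IsC21 u
  equation : ∀ x t : ℝ, 0 < t →
    dt u x t - dx (dx u) x t + h α x * u x t * dx u x t = 0
  /-- `u(x, t) = heatFlow u₀ x t + O(√t)` as `t → 0⁺`, uniformly for `x ∈ ℝ`. -/
  initial : ∃ C t₀ : ℝ, 0 < t₀ ∧ ∀ x t : ℝ, 0 < t → t < t₀ →
    |u x t - heatFlow u₀ x t| ≤ C * Real.sqrt t

end GenBurgers

end

noncomputable section

namespace GenBurgers

open Filter Topology

/-! The equation is read as a heat equation with source `-f`, where `f = h u u_x`, and solved in
mild form: heat flow of the data minus a Duhamel integral. The heat flow of bounded data has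
gradient of order `1/√t`, so sources of size `s^(-1/2)` are the natural class.

Existence up to a time `T` goes through truncation. Replacing `u` by its clamp to `[-M, M]` and `√t
u_x` by its clamp to `[-K, K]` makes the nonlinearity bounded and globally Lipschitz, so a
contraction in an exponentially weighted sup norm solves the problem for all times at once
(`exists_truncated_source`). The resulting source is 1/2-Hölder in space
(`isHolderSource_truncated`), which makes the mild solution classical (`isC21_mild`).

The truncation is then removed. A singular Gronwall argument (`sqrt_mul_abs_mildX_le_exp`) bounds
`√t |u_x|` by a constant depending on `M` and `T` but not on `K`, so `K` can be chosen to make its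
clamp inactive up to `T`. What remains is a linear equation `u_t = u_xx + b u_x` with bounded drift,
and the maximum principle gives `|u| ≤ M`, which removes the other clamp and yields the global
bound.

For uniqueness and stability, the difference `w = u - v` satisfies `w_t = w_xx - h v w_x - h u_x w`.
Only the gradient of `u` enters as a zeroth-order coefficient, and `L/√t` is integrable in time, so
`maximum_principle` gives `|w| ≤ δ exp (2 L √t)`. Since `u` may be the constructed solution, nothing
beyond boundedness and the initial condition is asked of the gradient of `v`. Uniqueness glues the
solutions on `(0, T]` into a global one. -/

/-! ### Gaussian kernels and their integrals. -/

/-- The heat kernel at time one, `exp (-z² / 4) / √(4π)`. -/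
def gauss0 (z : ℝ) : ℝ := Real.exp (-z ^ 2 / 4) / Real.sqrt (4 * Real.pi)

/-- The first derivative of `gauss0`. -/
def gauss1 (z : ℝ) : ℝ := -(z / 2) * gauss0 z

/-- The second derivative of `gauss0`. -/
def gauss2 (z : ℝ) : ℝ := (z ^ 2 / 4 - 1 / 2) * gauss0 z

/-- `k` is continuous and dominated by `C exp (-z² / 8)`. -/
structure GaussBound (k : ℝ → ℝ) (C : ℝ) : Prop where
  cont : Continuous k
  bound : ∀ z, |k z| ≤ C * Real.exp (-z ^ 2 / 8)

lemma GaussBound.nonneg {k : ℝ → ℝ} {C : ℝ} (h : GaussBound k C) : 0 ≤ C := by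
  have := (abs_nonneg _).trans (h.bound 0)
  simpa using this

lemma sqrt_four_pi_ge_one : 1 ≤ Real.sqrt (4 * Real.pi) := by
  rw [Real.one_le_sqrt]
  nlinarith [Real.pi_gt_three]

lemma hasDerivAt_gauss0 (z : ℝ) : HasDerivAt gauss0 (gauss1 z) z := by
  have h1 : HasDerivAt (fun z : ℝ => -z ^ 2 / 4) (-(z / 2)) z := by
    have := ((hasDerivAt_pow 2 z).neg).div_const 4
    exact this.congr_deriv (by norm_num; ring)
  have := (h1.exp).div_const (Real.sqrt (4 * Real.pi))
  exact this.congr_deriv (by simp only [gauss1, gauss0]; ring)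

lemma hasDerivAt_gauss1 (z : ℝ) : HasDerivAt gauss1 (gauss2 z) z := by
  have h1 : HasDerivAt (fun z : ℝ => -(z / 2)) (-(1 / 2)) z := ((hasDerivAt_id z).div_const 2).neg
  have := h1.mul (hasDerivAt_gauss0 z)
  exact this.congr_deriv (by simp only [gauss2, gauss1]; ring)

lemma continuous_gauss0 : Continuous gauss0 := by unfold gauss0; fun_prop

/-- Half of the Gaussian exponent is spent on absorbing the polynomial. With `y = z²/8` one has `z⁴
= 64 y²`, and `exp y ≥ 1 + y + y²/2` accounts for the factor 129 = 1 + 128. -/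
lemma gaussBound_poly_mul {p : ℝ → ℝ} {c : ℝ} (hc : 0 ≤ c) (hp : Continuous p)
    (h : ∀ z, |p z| ≤ c * (1 + z ^ 4)) : GaussBound (fun z => p z * gauss0 z) (129 * c) := by
  refine ⟨hp.mul continuous_gauss0, fun z => ?_⟩
  have h0 : 0 < Real.exp (-z ^ 2 / 4) := Real.exp_pos _
  have h1 : |gauss0 z| ≤ Real.exp (-z ^ 2 / 4) := by
    rw [gauss0, abs_div, abs_of_pos h0, abs_of_nonneg (Real.sqrt_nonneg _)]
    exact div_le_self h0.le sqrt_four_pi_ge_one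
  have h2 : 1 + z ^ 4 ≤ 129 * Real.exp (z ^ 2 / 8) := by
    have hy : 0 ≤ z ^ 2 / 8 := by positivity
    have := Real.quadratic_le_exp_of_nonneg hy
    nlinarith
  have h3 : Real.exp (-z ^ 2 / 4) * Real.exp (z ^ 2 / 8) = Real.exp (-z ^ 2 / 8) := by
    rw [← Real.exp_add]; congr 1; ring
  calc |p z * gauss0 z| = |p z| * |gauss0 z| := abs_mul _ _
    _ ≤ (c * (129 * Real.exp (z ^ 2 / 8))) * Real.exp (-z ^ 2 / 4) := by
        gcongr
        exact (h z).trans (by gcongr)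
    _ = 129 * c * Real.exp (-z ^ 2 / 8) := by rw [← h3]; ring

lemma gaussBound0 : GaussBound gauss0 129 := by
  have := gaussBound_poly_mul (p := fun _ => 1) (c := 1) zero_le_one continuous_const
    (fun z => by rw [abs_one]; nlinarith [sq_nonneg (z ^ 2)])
  simpa using this

lemma gaussBound1 : GaussBound gauss1 129 := by
  have := gaussBound_poly_mul (p := fun z => -(z / 2)) (c := 1) zero_le_one (by fun_prop)
    (fun z => by
      rw [abs_le]
      constructor <;> nlinarith [sq_nonneg (z ^ 2), sq_nonneg (z ^ 2 - 1), sq_nonneg (z - 1),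
        sq_nonneg (z + 1)])
  rw [mul_one] at this
  exact this

lemma gaussBound2 : GaussBound gauss2 129 := by
  have := gaussBound_poly_mul (p := fun z => z ^ 2 / 4 - 1 / 2) (c := 1) zero_le_one (by fun_prop)
    (fun z => by
      rw [abs_le]
      constructor <;> nlinarith [sq_nonneg (z ^ 2), sq_nonneg (z ^ 2 - 1)])
  rw [mul_one] at this
  exact this

lemma integrable_exp_neg_sq_div {c : ℝ} (hc : 0 < c) :
    Integrable (fun z : ℝ => Real.exp (-z ^ 2 / c)) := by
  have := integrable_exp_neg_mul_sq (b := 1 / c) (by positivity)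
  refine this.congr (Eventually.of_forall fun z => ?_)
  simp only []
  congr 1; ring

lemma GaussBound.integrable_abs {k : ℝ → ℝ} {C : ℝ} (h : GaussBound k C) :
    Integrable (fun z => |k z|) := by
  refine Integrable.mono' ((integrable_exp_neg_sq_div (c := 8) (by norm_num)).const_mul C)
    h.cont.abs.aestronglyMeasurable (Eventually.of_forall fun z => ?_)
  simpa using h.bound z

lemma GaussBound.integrable {k : ℝ → ℝ} {C : ℝ} (h : GaussBound k C) : Integrable k := by
  refine Integrable.mono' ((integrable_exp_neg_sq_div (c := 8) (by norm_num)).const_mul C)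
    h.cont.aestronglyMeasurable (Eventually.of_forall fun z => ?_)
  simpa using h.bound z

lemma GaussBound.integrable_abs_mul_sqrt {k : ℝ → ℝ} {C : ℝ} (h : GaussBound k C) :
    Integrable (fun z => |k z| * Real.sqrt |z|) := by
  refine Integrable.mono' ((integrable_exp_neg_sq_div (c := 16) (by norm_num)).const_mul (17 * C))
    (h.cont.abs.mul (by fun_prop)).aestronglyMeasurable (Eventually.of_forall fun z => ?_)
  have hC := h.nonneg
  rw [Real.norm_of_nonneg (by positivity)]
  have h1 : Real.sqrt |z| ≤ 17 * Real.exp (z ^ 2 / 16) := by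
    have h2 := Real.add_one_le_exp (z ^ 2 / 16)
    have h3 : Real.sqrt |z| ≤ 1 + |z| := by
      rw [Real.sqrt_le_left (by positivity)]
      nlinarith [abs_nonneg z]
    nlinarith [sq_abs z, sq_nonneg (|z| - 1), sq_nonneg z]
  have h3 : Real.exp (-z ^ 2 / 8) * Real.exp (z ^ 2 / 16) = Real.exp (-z ^ 2 / 16) := by
    rw [← Real.exp_add]; congr 1; ring
  calc |k z| * Real.sqrt |z| ≤ (C * Real.exp (-z ^ 2 / 8)) * (17 * Real.exp (z ^ 2 / 16)) := by
        gcongr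
        exact h.bound z
    _ = 17 * C * Real.exp (-z ^ 2 / 16) := by rw [← h3]; ring

lemma integral_gauss0 : ∫ z, gauss0 z = 1 := by
  have h := integral_gaussian (1 / 4)
  have h2 : ∀ z : ℝ, gauss0 z = Real.exp (-(1 / 4) * z ^ 2) * (Real.sqrt (4 * Real.pi))⁻¹ := by
    intro z; rw [gauss0, div_eq_mul_inv]; congr 2; ring
  simp_rw [h2]
  rw [integral_mul_const, h]
  have : Real.pi / (1 / 4) = 4 * Real.pi := by ring
  rw [this]
  exact mul_inv_cancel₀ (by linarith [sqrt_four_pi_ge_one])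

lemma tendsto_of_gaussBound {k : ℝ → ℝ} {C : ℝ} (h : GaussBound k C) :
    Tendsto k atTop (𝓝 0) ∧ Tendsto k atBot (𝓝 0) := by
  have h1 : Tendsto (fun z : ℝ => z ^ 2 / 8) atTop atTop :=
    (tendsto_pow_atTop two_ne_zero).atTop_div_const (by norm_num)
  have h2 : Tendsto (fun z : ℝ => z ^ 2 / 8) atBot atTop := by
    have := h1.comp tendsto_neg_atBot_atTop
    refine this.congr fun z => ?_
    simp
  have key : ∀ l : Filter ℝ, Tendsto (fun z : ℝ => z ^ 2 / 8) l atTop → Tendsto k l (𝓝 0) := by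
    intro l hl
    refine squeeze_zero_norm (a := fun z => C * Real.exp (-(z ^ 2 / 8))) (fun z => ?_) ?_
    · have := h.bound z
      rw [neg_div] at this
      simpa using this
    · simpa using (Real.tendsto_exp_neg_atTop_nhds_zero.comp hl).const_mul C
  exact ⟨key _ h1, key _ h2⟩

/-- This cancellation is what tames the non-integrable factor `(t - s)^(-1)` in second derivatives.
-/
lemma integral_gauss2 : ∫ z, gauss2 z = 0 := by
  have := integral_of_hasDerivAt_of_tendsto (f := gauss1) (f' := gauss2) (m := 0) (n := 0)
    hasDerivAt_gauss1 gaussBound2.integrable (tendsto_of_gaussBound gaussBound1).2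
    (tendsto_of_gaussBound gaussBound1).1
  simpa using this

/-! ### Gaussian averages of bounded functions. -/

/-- The scaled average `∫ k(z) g(x - √t z) dz`. -/
def smooth (k : ℝ → ℝ) (t : ℝ) (g : ℝ → ℝ) (x : ℝ) : ℝ :=
  ∫ z, k z * g (x - Real.sqrt t * z)

lemma abs_smooth_le {k : ℝ → ℝ} {C : ℝ} (h : GaussBound k C) {g : ℝ → ℝ} {A : ℝ}
    (hg : ∀ x, |g x| ≤ A) (t x : ℝ) : |smooth k t g x| ≤ (∫ z, |k z|) * A := by
  rw [← integral_mul_const]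
  rw [← Real.norm_eq_abs]
  refine MeasureTheory.norm_integral_le_of_norm_le (h.integrable_abs.mul_const A)
    (Eventually.of_forall fun z => ?_)
  rw [Real.norm_eq_abs, abs_mul]
  gcongr
  exact hg _

lemma integrable_smooth {k : ℝ → ℝ} {C : ℝ} (h : GaussBound k C) {g : ℝ → ℝ} {A : ℝ}
    (hm : Measurable g) (hg : ∀ x, |g x| ≤ A) (t x : ℝ) :
    Integrable fun z => k z * g (x - Real.sqrt t * z) := by
  refine Integrable.mono' (h.integrable_abs.mul_const A)
    (h.cont.measurable.mul (by fun_prop)).aestronglyMeasurable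
    (Eventually.of_forall fun z => ?_)
  rw [Real.norm_eq_abs, abs_mul]
  gcongr
  exact hg _

lemma smooth_sub {k : ℝ → ℝ} {C : ℝ} (h : GaussBound k C) {g₁ g₂ : ℝ → ℝ} {A₁ A₂ : ℝ}
    (hm₁ : Measurable g₁) (hg₁ : ∀ x, |g₁ x| ≤ A₁) (hm₂ : Measurable g₂) (hg₂ : ∀ x, |g₂ x| ≤ A₂)
    (t x : ℝ) :
    smooth k t (fun y => g₁ y - g₂ y) x = smooth k t g₁ x - smooth k t g₂ x := by
  rw [smooth, smooth, smooth, ← integral_sub (integrable_smooth h hm₁ hg₁ t x)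
    (integrable_smooth h hm₂ hg₂ t x)]
  simp_rw [mul_sub]

/-- Since `k` has mean zero, `g x` may be subtracted under the integral. The Hölder bound over the
distance `√t |z|` then gains a factor `t^(1/4)`. -/
lemma abs_smooth_le_of_holder {k : ℝ → ℝ} {C : ℝ} (h : GaussBound k C) (hk : ∫ z, k z = 0)
    {g : ℝ → ℝ} {A H : ℝ} (hm : Measurable g) (hg : ∀ x, |g x| ≤ A)
    (hH : ∀ x y, |g x - g y| ≤ H * Real.sqrt |x - y|) (t x : ℝ) :
    |smooth k t g x| ≤ (∫ z, |k z| * Real.sqrt |z|) * (H * Real.sqrt (Real.sqrt t)) := by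
  have h1 : smooth k t g x = ∫ z, k z * (g (x - Real.sqrt t * z) - g x) := by
    simp_rw [mul_sub]
    rw [integral_sub (integrable_smooth h hm hg t x) (h.integrable.mul_const _),
      integral_mul_const, hk, zero_mul, sub_zero, smooth]
  rw [h1, ← integral_mul_const]
  rw [← Real.norm_eq_abs]
  refine MeasureTheory.norm_integral_le_of_norm_le (h.integrable_abs_mul_sqrt.mul_const _)
    (Eventually.of_forall fun z => ?_)
  rw [Real.norm_eq_abs, abs_mul, mul_assoc]
  gcongr
  refine (hH _ _).trans (le_of_eq ?_)
  have : |x - Real.sqrt t * z - x| = |z| * Real.sqrt t := by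
    rw [show x - Real.sqrt t * z - x = -(z * Real.sqrt t) by ring, abs_neg, abs_mul,
      abs_of_nonneg (Real.sqrt_nonneg t)]
  rw [this, Real.sqrt_mul (abs_nonneg z)]; ring

/-- The substitution `y = x - √t z` moves the dependence on `x` and `t` from `g` to the kernel, so
that averages can be differentiated when `g` is merely bounded and measurable. -/
lemma smooth_eq_kernel (k : ℝ → ℝ) {t : ℝ} (ht : 0 < t) (g : ℝ → ℝ) (x : ℝ) :
    smooth k t g x = ∫ y, (Real.sqrt t)⁻¹ * k ((x - y) / Real.sqrt t) * g y := by
  have hs : 0 < Real.sqrt t := Real.sqrt_pos.2 ht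
  have h1 := integral_sub_left_eq_self
    (fun y => (Real.sqrt t)⁻¹ * k ((x - y) / Real.sqrt t) * g y) volume x
  have h2 := Measure.integral_comp_mul_left
    (fun y => (Real.sqrt t)⁻¹ * k ((x - (x - y)) / Real.sqrt t) * g (x - y)) (Real.sqrt t)
  rw [← h1]
  rw [abs_of_pos (inv_pos.2 hs), smul_eq_mul, eq_comm, inv_mul_eq_iff_eq_mul₀ hs.ne'] at h2
  rw [h2, ← integral_const_mul, smooth]
  congr 1; ext z
  have : (x - (x - Real.sqrt t * z)) / Real.sqrt t = z := by field_simp; ring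
  rw [this]; field_simp

/-- A single integrable majorant for all `(x, t)` near `(x₀, t₀)`, as dominated convergence
requires. It follows from `(x₀ - y)² ≤ 2 (x - y)² + 2` and `t < 2 t₀`. -/
lemma GaussBound.abs_comp_le {k : ℝ → ℝ} {C : ℝ} (h : GaussBound k C) {x₀ t₀ x t y : ℝ}
    (hx : |x - x₀| ≤ 1) (ht₀ : 0 < t₀) (ht : t₀ / 2 < t) (ht' : t < 2 * t₀) :
    |k ((x - y) / Real.sqrt t)| ≤
      C * Real.exp (1 / (16 * t₀)) * Real.exp (-(x₀ - y) ^ 2 / (32 * t₀)) := by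
  have htp : 0 < t := by linarith
  refine (h.bound _).trans ?_
  rw [mul_assoc, ← Real.exp_add]
  have hC := h.nonneg
  gcongr
  rw [div_pow, Real.sq_sqrt htp.le]
  have h1 : (x₀ - y) ^ 2 ≤ 2 * (x - y) ^ 2 + 2 := by
    have : (x - x₀) ^ 2 ≤ 1 := by rw [← sq_abs]; nlinarith [abs_nonneg (x - x₀)]
    nlinarith [sq_nonneg (x - y + (x - x₀))]
  have h2 : (x - y) ^ 2 / (2 * t₀) ≤ (x - y) ^ 2 / t := by gcongr
  have h3 : 1 / (16 * t₀) + -(x₀ - y) ^ 2 / (32 * t₀) = (2 - (x₀ - y) ^ 2) / (32 * t₀) := by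
    field_simp; ring
  rw [h3]
  have h4 : -(2 * (x - y) ^ 2) / (32 * t₀) ≤ (2 - (x₀ - y) ^ 2) / (32 * t₀) := by
    gcongr; linarith
  have h5 : -(2 * (x - y) ^ 2) / (32 * t₀) = -((x - y) ^ 2 / (2 * t₀)) / 8 := by
    field_simp; ring
  rw [h5] at h4
  linarith

lemma integrable_exp_shift (x₀ : ℝ) {c : ℝ} (hc : 0 < c) :
    Integrable (fun y : ℝ => Real.exp (-(x₀ - y) ^ 2 / c)) :=
  (integrable_exp_neg_sq_div hc).comp_sub_left x₀

lemma continuousAt_smooth {k : ℝ → ℝ} {C : ℝ} (h : GaussBound k C) {g : ℝ → ℝ} {A : ℝ}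
    (hm : Measurable g) (hg : ∀ x, |g x| ≤ A) (x₀ : ℝ) {t₀ : ℝ} (ht₀ : 0 < t₀) :
    ContinuousAt (fun p : ℝ × ℝ => smooth k p.2 g p.1) (x₀, t₀) := by
  have hA : 0 ≤ A := (abs_nonneg _).trans (hg 0)
  have hnear : ∀ᶠ p : ℝ × ℝ in 𝓝 (x₀, t₀), |p.1 - x₀| ≤ 1 ∧ t₀ / 2 < p.2 ∧ p.2 < 2 * t₀ := by
    have e1 : ∀ᶠ x in 𝓝 x₀, |x - x₀| ≤ 1 := by
      filter_upwards [Metric.closedBall_mem_nhds x₀ one_pos] with x hx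
      simpa [Real.dist_eq] using hx
    have e2 : ∀ᶠ t in 𝓝 t₀, t₀ / 2 < t ∧ t < 2 * t₀ :=
      Ioo_mem_nhds (by linarith) (by linarith)
    rw [nhds_prod_eq]
    exact e1.prod_mk e2
  have heq : (fun p : ℝ × ℝ => smooth k p.2 g p.1) =ᶠ[𝓝 (x₀, t₀)]
      fun p => ∫ y, (Real.sqrt p.2)⁻¹ * k ((p.1 - y) / Real.sqrt p.2) * g y := by
    filter_upwards [hnear] with p hp
    exact smooth_eq_kernel k (by linarith [hp.2.1]) g p.1
  refine ContinuousAt.congr ?_ heq.symm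
  refine continuousAt_of_dominated
    (bound := fun y => (Real.sqrt (t₀ / 2))⁻¹ * (C * Real.exp (1 / (16 * t₀)) *
      Real.exp (-(x₀ - y) ^ 2 / (32 * t₀))) * A) ?_ ?_ ?_ ?_
  · refine Eventually.of_forall fun p => Measurable.aestronglyMeasurable ?_
    have := h.cont.measurable
    fun_prop
  · filter_upwards [hnear] with p hp
    refine Eventually.of_forall fun y => ?_
    rw [Real.norm_eq_abs, abs_mul, abs_mul, abs_of_nonneg (inv_nonneg.2 (Real.sqrt_nonneg _))]
    have hb := h.abs_comp_le (y := y) hp.1 ht₀ hp.2.1 hp.2.2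
    have : Real.sqrt (t₀ / 2) ≤ Real.sqrt p.2 := Real.sqrt_le_sqrt hp.2.1.le
    have h0 : 0 < Real.sqrt (t₀ / 2) := Real.sqrt_pos.2 (by linarith)
    have hC := h.nonneg
    gcongr
    exact hg y
  · exact (((integrable_exp_shift x₀ (by positivity)).const_mul _).const_mul _).mul_const _
  · refine Eventually.of_forall fun y => ?_
    have hk := h.cont
    have hs : Real.sqrt (x₀, t₀).2 ≠ 0 := (Real.sqrt_pos.2 ht₀).ne'
    refine ContinuousAt.mul (ContinuousAt.mul ?_ ?_) continuousAt_const
    · exact ContinuousAt.inv₀ (by fun_prop) hs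
    · exact hk.continuousAt.comp (ContinuousAt.div (by fun_prop) (by fun_prop) hs)

lemma hasDerivAt_smooth_x {k k' : ℝ → ℝ} {C C' : ℝ} (h : GaussBound k C) (h' : GaussBound k' C')
    (hk : ∀ z, HasDerivAt k (k' z) z) {g : ℝ → ℝ} {A : ℝ}
    (hm : Measurable g) (hg : ∀ x, |g x| ≤ A) {t : ℝ} (ht : 0 < t) (x₀ : ℝ) :
    HasDerivAt (fun x => smooth k t g x) ((Real.sqrt t)⁻¹ * smooth k' t g x₀) x₀ := by
  have hA : 0 ≤ A := (abs_nonneg _).trans (hg 0)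
  have hs : 0 < Real.sqrt t := Real.sqrt_pos.2 ht
  simp_rw [smooth_eq_kernel _ ht]
  rw [← integral_const_mul]
  have hkm := h.cont.measurable
  have hkm' := h'.cont.measurable
  have hint : ∀ x, Integrable (fun y => (Real.sqrt t)⁻¹ * k ((x - y) / Real.sqrt t) * g y) := by
    intro x
    refine Integrable.mono' (((((integrable_exp_shift x (c := 32 * t) (by positivity)).const_mul
      (C * Real.exp (1 / (16 * t)))).const_mul (Real.sqrt t)⁻¹)).mul_const A)
      (by apply Measurable.aestronglyMeasurable; fun_prop) (Eventually.of_forall fun y => ?_)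
    rw [Real.norm_eq_abs, abs_mul, abs_mul, abs_of_pos (inv_pos.2 hs)]
    have hC := h.nonneg
    gcongr
    · exact h.abs_comp_le (by simp) ht (by linarith) (by linarith)
    · exact hg y
  refine (hasDerivAt_integral_of_dominated_loc_of_deriv_le
    (F := fun x y => (Real.sqrt t)⁻¹ * k ((x - y) / Real.sqrt t) * g y)
    (F' := fun x y => (Real.sqrt t)⁻¹ * ((Real.sqrt t)⁻¹ * k' ((x - y) / Real.sqrt t) * g y))
    (bound := fun y => (Real.sqrt t)⁻¹ * ((Real.sqrt t)⁻¹ * (C' * Real.exp (1 / (16 * t)) *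
      Real.exp (-(x₀ - y) ^ 2 / (32 * t))) * A))
    (Metric.closedBall_mem_nhds x₀ one_pos) ?_ (hint x₀) ?_ ?_ ?_ ?_).2
  · exact Eventually.of_forall fun x => (hint x).aestronglyMeasurable
  · apply Measurable.aestronglyMeasurable; fun_prop
  · refine Eventually.of_forall fun y x hx => ?_
    rw [Real.norm_eq_abs, abs_mul, abs_mul, abs_mul, abs_of_pos (inv_pos.2 hs)]
    have hC := h'.nonneg
    rw [Metric.mem_closedBall, Real.dist_eq] at hx
    gcongr
    · exact h'.abs_comp_le hx ht (by linarith) (by linarith)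
    · exact hg y
  · exact ((((integrable_exp_shift x₀ (by positivity)).const_mul _).const_mul _).mul_const
      _).const_mul _
  · refine Eventually.of_forall fun y x _ => ?_
    have h1 : HasDerivAt (fun x => (x - y) / Real.sqrt t) ((Real.sqrt t)⁻¹) x := by
      simpa using ((hasDerivAt_id x).sub_const y).div_const (Real.sqrt t)
    have h2 := (((hk ((x - y) / Real.sqrt t)).comp x h1).const_mul (Real.sqrt t)⁻¹).mul_const (g y)
    exact h2.congr_deriv (by ring)

/-- This is the heat equation: by self-similarity, the time derivative of `t^(-1/2) gauss0 ((x -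
y)/√t)` equals its second space derivative, because `-gauss0/2 - (z/2) gauss1 = gauss2`. -/
lemma hasDerivAt_smooth_t {g : ℝ → ℝ} {A : ℝ}
    (hm : Measurable g) (hg : ∀ x, |g x| ≤ A) {t₀ : ℝ} (ht : 0 < t₀) (x : ℝ) :
    HasDerivAt (fun t => smooth gauss0 t g x) (t₀⁻¹ * smooth gauss2 t₀ g x) t₀ := by
  have hA : 0 ≤ A := (abs_nonneg _).trans (hg 0)
  have hkm := gaussBound0.cont.measurable
  have hkm' := gaussBound2.cont.measurable
  have hint : ∀ {k : ℝ → ℝ} {C : ℝ} (h : GaussBound k C), ∀ t, t₀ / 2 < t → t < 2 * t₀ →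
      ∀ y, |(Real.sqrt t)⁻¹ * k ((x - y) / Real.sqrt t) * g y| ≤ (Real.sqrt (t₀ / 2))⁻¹ *
      (C * Real.exp (1 / (16 * t₀)) * Real.exp (-(x - y) ^ 2 / (32 * t₀))) * A := by
    intro k C h t h1 h2 y
    rw [abs_mul, abs_mul, abs_of_nonneg (inv_nonneg.2 (Real.sqrt_nonneg _))]
    have hb := h.abs_comp_le (x := x) (x₀ := x) (y := y) (by simp) ht h1 h2
    have : Real.sqrt (t₀ / 2) ≤ Real.sqrt t := Real.sqrt_le_sqrt h1.le
    have h0 : 0 < Real.sqrt (t₀ / 2) := Real.sqrt_pos.2 (by linarith)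
    have hC := h.nonneg
    gcongr
    exact hg y
  have hbi : ∀ C, Integrable (fun y => (Real.sqrt (t₀ / 2))⁻¹ *
      (C * Real.exp (1 / (16 * t₀)) * Real.exp (-(x - y) ^ 2 / (32 * t₀))) * A) := fun C =>
    (((integrable_exp_shift x (by positivity)).const_mul _).const_mul _).mul_const _
  have hnhd : Ioo (t₀ / 2) (2 * t₀) ∈ 𝓝 t₀ := Ioo_mem_nhds (by linarith) (by linarith)
  have heq : (fun t => smooth gauss0 t g x) =ᶠ[𝓝 t₀]
      fun t => ∫ y, (Real.sqrt t)⁻¹ * gauss0 ((x - y) / Real.sqrt t) * g y := by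
    filter_upwards [hnhd] with t h
    exact smooth_eq_kernel _ (by linarith [h.1]) g x
  refine HasDerivAt.congr_of_eventuallyEq ?_ heq
  rw [smooth_eq_kernel _ ht, ← integral_const_mul]
  have hI := (hint gaussBound0) t₀ (by linarith) (by linarith)
  refine (hasDerivAt_integral_of_dominated_loc_of_deriv_le
    (F := fun t y => (Real.sqrt t)⁻¹ * gauss0 ((x - y) / Real.sqrt t) * g y)
    (F' := fun t y => t⁻¹ * ((Real.sqrt t)⁻¹ * gauss2 ((x - y) / Real.sqrt t) * g y))
    (bound := fun y => (t₀ / 2)⁻¹ * ((Real.sqrt (t₀ / 2))⁻¹ * (129 * Real.exp (1 / (16 * t₀)) *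
      Real.exp (-(x - y) ^ 2 / (32 * t₀))) * A)) hnhd ?_ ?_ ?_ ?_ ?_ ?_).2
  · refine Eventually.of_forall fun t => ?_
    apply Measurable.aestronglyMeasurable; fun_prop
  · refine Integrable.mono' (hbi 129) ?_ (Eventually.of_forall hI)
    apply Measurable.aestronglyMeasurable; fun_prop
  · apply Measurable.aestronglyMeasurable; fun_prop
  · refine Eventually.of_forall fun y t hx => ?_
    have h0 : 0 < t₀ / 2 := by linarith
    have htp : 0 < t := by linarith [hx.1]
    rw [Real.norm_eq_abs, abs_mul, abs_of_pos (inv_pos.2 htp)]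
    gcongr
    · exact hx.1.le
    · exact hint gaussBound2 t hx.1 hx.2 y
  · exact (hbi 129).const_mul _
  · refine Eventually.of_forall fun y t hx => ?_
    have h0 : 0 < t := by linarith [hx.1]
    have hs : 0 < Real.sqrt t := Real.sqrt_pos.2 h0
    have h1 := Real.hasDerivAt_sqrt h0.ne'
    have h2 := h1.inv hs.ne'
    have h3 : HasDerivAt (fun t => (x - y) / Real.sqrt t)
        ((x - y) * (-(1 / (2 * Real.sqrt t)) / Real.sqrt t ^ 2)) t := by
      simpa [div_eq_mul_inv] using h2.const_mul (x - y)
    have h4 := (h2.mul ((hasDerivAt_gauss0 ((x - y) / Real.sqrt t)).comp t h3)).mul_const (g y)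
    refine h4.congr_deriv ?_
    simp only [gauss1, gauss2, Function.comp, Pi.inv_apply]
    have e : t = Real.sqrt t ^ 2 := (Real.sq_sqrt h0.le).symm
    set r := Real.sqrt t
    rw [e]
    field_simp
    ring

lemma heatFlow_eq_smooth (u₀ : ℝ → ℝ) (x : ℝ) {t : ℝ} (ht : 0 < t) :
    heatFlow u₀ x t = smooth gauss0 t u₀ x := by
  have hs : 0 < Real.sqrt t := Real.sqrt_pos.2 ht
  rw [smooth_eq_kernel _ ht, heatFlow]
  congr 1; ext y
  rw [gauss0, Real.sqrt_mul (by positivity : (0:ℝ) ≤ 4 * Real.pi), div_pow, Real.sq_sqrt ht.le]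
  have h1 : -((x - y) ^ 2 / t) / 4 = -(x - y) ^ 2 / (4 * t) := by field_simp
  rw [h1]
  have := sqrt_four_pi_ge_one
  have h2 : Real.sqrt (4 * Real.pi) ≠ 0 := by linarith
  field_simp

/-! ### Time integrals with singularities at both endpoints. -/

lemma aestronglyMeasurable_uIoc_of_continuousOn {f : ℝ → ℝ} {a b : ℝ} (hab : a ≤ b)
    (hf : ContinuousOn f (Ioo a b)) : AEStronglyMeasurable f (volume.restrict (uIoc a b)) := by
  rw [uIoc_of_le hab, ← restrict_Ioo_eq_restrict_Ioc]
  exact hf.aestronglyMeasurable measurableSet_Ioo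

lemma ae_mem_Ioo_of_mem_uIoc {a b : ℝ} (hab : a ≤ b) :
    ∀ᵐ s : ℝ, s ∈ uIoc a b → s ∈ Ioo a b := by
  have : ∀ᵐ s : ℝ, s ≠ b := by simp [ae_iff]
  filter_upwards [this] with s hs h
  rw [uIoc_of_le hab] at h
  exact ⟨h.1, lt_of_le_of_ne h.2 hs⟩

lemma intervalIntegrable_beta {a b t : ℝ} (ha : a < 1) (hb : b < 1) (ht : 0 < t) :
    IntervalIntegrable (fun s => (t - s) ^ (-a) * s ^ (-b)) volume 0 t := by
  have h1 : IntervalIntegrable (fun s => (t - s) ^ (-a) * s ^ (-b)) volume 0 (t / 2) := by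
    refine IntervalIntegrable.continuousOn_mul (intervalIntegral.intervalIntegrable_rpow'
      (by linarith)) ?_
    intro s hs
    rw [uIcc_of_le (by linarith)] at hs
    refine ContinuousAt.continuousWithinAt ?_
    exact ContinuousAt.rpow_const (by fun_prop) (Or.inl (by linarith [hs.2]))
  have h2 : IntervalIntegrable (fun s => (t - s) ^ (-a) * s ^ (-b)) volume (t / 2) t := by
    refine IntervalIntegrable.mul_continuousOn ?_ ?_
    · have := (intervalIntegral.intervalIntegrable_rpow' (a := t / 2) (b := 0) (r := -a)
        (by linarith)).comp_sub_left t
      convert this using 1 <;> ring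
    · intro s hs
      rw [uIcc_of_le (by linarith)] at hs
      refine ContinuousAt.continuousWithinAt ?_
      exact ContinuousAt.rpow_const (by fun_prop) (Or.inl (by linarith [hs.1]))
  exact h1.trans h2

/-- The Beta integral `∫₀¹ (1 - r)^(-a) r^(-b) dr`. -/
def betaInt (a b : ℝ) : ℝ := ∫ r in (0:ℝ)..1, (1 - r) ^ (-a) * r ^ (-b)

lemma betaInt_nonneg (a b : ℝ) : 0 ≤ betaInt a b := by
  refine intervalIntegral.integral_nonneg zero_le_one fun r hr => ?_
  exact mul_nonneg (Real.rpow_nonneg (by linarith [hr.2]) _) (Real.rpow_nonneg hr.1 _)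

lemma integral_beta (a b : ℝ) {t : ℝ} (ht : 0 < t) :
    ∫ s in (0:ℝ)..t, (t - s) ^ (-a) * s ^ (-b) = t ^ (1 - a - b) * betaInt a b := by
  have h := intervalIntegral.mul_integral_comp_mul_left (a := 0) (b := 1)
    (f := fun s => (t - s) ^ (-a) * s ^ (-b)) t
  rw [mul_zero, mul_one] at h
  rw [← h, betaInt, ← intervalIntegral.integral_const_mul, ← intervalIntegral.integral_const_mul]
  refine intervalIntegral.integral_congr fun r hr => ?_
  rw [uIcc_of_le zero_le_one] at hr
  rw [show t - t * r = t * (1 - r) by ring, Real.mul_rpow ht.le (by linarith [hr.2]),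
    Real.mul_rpow ht.le hr.1, show (1 - a - b) = 1 + -a + -b by ring, Real.rpow_add ht,
    Real.rpow_add ht, Real.rpow_one]
  ring

/-- `K x t s` is continuous on `0 < s < t` and dominated, uniformly in `x`, by a multiple of the
integrable singularity `(t - s)^(-a) s^(-b)`. -/
structure SingularKernel (K : ℝ → ℝ → ℝ → ℝ) (a b : ℝ) : Prop where
  a_nonneg : 0 ≤ a
  a_lt : a < 1
  b_nonneg : 0 ≤ b
  b_lt : b < 1
  cont : ContinuousOn (fun q : ℝ × ℝ × ℝ => K q.1 q.2.1 q.2.2) {q | 0 < q.2.2 ∧ q.2.2 < q.2.1}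
  bound : ∀ T, 0 < T → ∃ C, 0 ≤ C ∧ ∀ x t s, 0 < s → s < t → t ≤ T →
    |K x t s| ≤ C * ((t - s) ^ (-a) * s ^ (-b))

lemma isOpen_triangle : IsOpen {q : ℝ × ℝ × ℝ | 0 < q.2.2 ∧ q.2.2 < q.2.1} := by
  have h1 : IsOpen {q : ℝ × ℝ × ℝ | 0 < q.2.2} := isOpen_lt continuous_const (by fun_prop)
  have h2 : IsOpen {q : ℝ × ℝ × ℝ | q.2.2 < q.2.1} := isOpen_lt (by fun_prop) (by fun_prop)
  exact h1.inter h2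

lemma isOpen_domain : IsOpen domain := isOpen_univ.prod isOpen_Ioi

lemma abs_integral_le_beta {F : ℝ → ℝ} {a b C t : ℝ} (ha : a < 1) (hb : b < 1) (ht : 0 < t)
    (hF : ∀ s, 0 < s → s < t → |F s| ≤ C * ((t - s) ^ (-a) * s ^ (-b))) :
    |∫ s in (0:ℝ)..t, F s| ≤ C * (t ^ (1 - a - b) * betaInt a b) := by
  rw [← integral_beta a b ht, ← intervalIntegral.integral_const_mul, ← Real.norm_eq_abs]
  refine intervalIntegral.norm_integral_le_of_norm_le ht.le ?_
    ((intervalIntegrable_beta ha hb ht).const_mul C)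
  filter_upwards [ae_mem_Ioo_of_mem_uIoc ht.le] with s hs h
  rw [uIoc_of_le ht.le] at hs
  exact hF s (hs h).1 (hs h).2

namespace SingularKernel

variable {K K' : ℝ → ℝ → ℝ → ℝ} {a b a' b' : ℝ}

lemma continuousAt (h : SingularKernel K a b) {x t s : ℝ} (hs : 0 < s) (hst : s < t) :
    ContinuousAt (fun q : ℝ × ℝ × ℝ => K q.1 q.2.1 q.2.2) (x, t, s) :=
  h.cont.continuousAt (isOpen_triangle.mem_nhds ⟨hs, hst⟩)

lemma continuousOn_s (h : SingularKernel K a b) (x t : ℝ) :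
    ContinuousOn (fun s => K x t s) (Ioo 0 t) := fun s hs =>
  (ContinuousAt.comp (f := fun s : ℝ => ((x, t, s) : ℝ × ℝ × ℝ))
    (h.continuousAt (x := x) hs.1 hs.2) (by fun_prop)).continuousWithinAt

lemma intervalIntegrable (h : SingularKernel K a b) (x : ℝ) {t : ℝ} (ht : 0 < t) :
    IntervalIntegrable (fun s => K x t s) volume 0 t := by
  obtain ⟨C, hC0, hC⟩ := h.bound t ht
  refine IntervalIntegrable.mono_fun' ((intervalIntegrable_beta h.a_lt h.b_lt ht).const_mul C)
    (aestronglyMeasurable_uIoc_of_continuousOn ht.le (h.continuousOn_s x t)) ?_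
  rw [EventuallyLE, ae_restrict_iff' measurableSet_uIoc]
  filter_upwards [ae_mem_Ioo_of_mem_uIoc ht.le] with s hs h'
  exact hC x t s (hs h').1 (hs h').2 le_rfl

lemma continuousOn_integral (h : SingularKernel K a b) :
    ContinuousOn (fun p : ℝ × ℝ => ∫ s in (0:ℝ)..p.2, K p.1 p.2 s) domain := by
  rintro ⟨x₀, t₀⟩ ⟨-, ht₀⟩
  have ht₀ : 0 < t₀ := ht₀
  refine ContinuousAt.continuousWithinAt ?_
  obtain ⟨C, hC0, hC⟩ := h.bound (2 * t₀) (by positivity)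
  -- Rescaling `s = t r` fixes both the interval and the singular points, so dominated convergence
  -- applies with a majorant in `r` alone.
  have heq : (fun p : ℝ × ℝ => ∫ s in (0:ℝ)..p.2, K p.1 p.2 s) =
      fun p => p.2 * ∫ r in (0:ℝ)..1, K p.1 p.2 (p.2 * r) := by
    ext p
    have := intervalIntegral.mul_integral_comp_mul_left (a := 0) (b := 1)
      (f := fun s => K p.1 p.2 s) p.2
    rw [mul_zero, mul_one] at this
    exact this.symm
  rw [heq]
  have hnear : ∀ᶠ p : ℝ × ℝ in 𝓝 (x₀, t₀), t₀ / 2 < p.2 ∧ p.2 < 2 * t₀ :=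
    continuous_snd.continuousAt.eventually (Ioo_mem_nhds (by simp; linarith) (by simp; linarith))
  refine continuous_snd.continuousAt.mul ?_
  refine intervalIntegral.continuousAt_of_dominated_interval
    (bound := fun r => C * (t₀ / 2) ^ (-a - b) * ((1 - r) ^ (-a) * r ^ (-b))) ?_ ?_ ?_ ?_
  · filter_upwards [hnear] with p hp
    refine aestronglyMeasurable_uIoc_of_continuousOn zero_le_one ?_
    have htp : 0 < p.2 := by linarith [hp.1]
    refine (h.continuousOn_s p.1 p.2).comp (by fun_prop) fun r hr => ?_
    exact ⟨mul_pos htp hr.1, by nlinarith [hr.2]⟩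
  · filter_upwards [hnear] with p hp
    have htp : 0 < p.2 := by linarith [hp.1]
    filter_upwards [ae_mem_Ioo_of_mem_uIoc (zero_le_one' ℝ)] with r hr hr'
    obtain ⟨h1, h2⟩ := hr hr'
    refine (hC p.1 p.2 (p.2 * r) (mul_pos htp h1) (by nlinarith) hp.2.le).trans ?_
    rw [show p.2 - p.2 * r = p.2 * (1 - r) by ring, Real.mul_rpow htp.le (by linarith),
      Real.mul_rpow htp.le h1.le, mul_assoc C]
    refine mul_le_mul_of_nonneg_left ?_ hC0
    have h3 : p.2 ^ (-a - b) ≤ (t₀ / 2) ^ (-a - b) :=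
      Real.rpow_le_rpow_of_nonpos (by linarith) hp.1.le (by linarith [h.a_nonneg, h.b_nonneg])
    have h4 : 0 ≤ (1 - r) ^ (-a) * r ^ (-b) :=
      mul_nonneg (Real.rpow_nonneg (by linarith) _) (Real.rpow_nonneg h1.le _)
    calc _ = p.2 ^ (-a - b) * ((1 - r) ^ (-a) * r ^ (-b)) := by
          rw [show -a - b = -a + -b by ring, Real.rpow_add htp]; ring
      _ ≤ _ := mul_le_mul_of_nonneg_right h3 h4
  · exact (intervalIntegrable_beta h.a_lt h.b_lt one_pos).const_mul _
  · filter_upwards [ae_mem_Ioo_of_mem_uIoc (zero_le_one' ℝ)] with r hr hr'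
    obtain ⟨h1, h2⟩ := hr hr'
    exact ContinuousAt.comp (x := (x₀, t₀))
      (f := fun p : ℝ × ℝ => ((p.1, p.2, p.2 * r) : ℝ × ℝ × ℝ))
      (h.continuousAt (x := x₀) (t := t₀) (s := t₀ * r) (mul_pos ht₀ h1) (by nlinarith))
      (by fun_prop)

lemma hasDerivAt_integral (h : SingularKernel K a b) (h' : SingularKernel K' a' b')
    (hd : ∀ x t s, 0 < s → s < t → HasDerivAt (fun x => K x t s) (K' x t s) x)
    (x : ℝ) {t : ℝ} (ht : 0 < t) :
    HasDerivAt (fun x => ∫ s in (0:ℝ)..t, K x t s) (∫ s in (0:ℝ)..t, K' x t s) x := by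
  obtain ⟨C, hC0, hC⟩ := h'.bound t ht
  refine (intervalIntegral.hasDerivAt_integral_of_dominated_loc_of_deriv_le
    (F := fun x s => K x t s) (F' := fun x s => K' x t s)
    (bound := fun s => C * ((t - s) ^ (-a') * s ^ (-b'))) univ_mem ?_
    (h.intervalIntegrable x ht) ?_ ?_ ?_ ?_).2
  · exact Eventually.of_forall fun y =>
      aestronglyMeasurable_uIoc_of_continuousOn ht.le (h.continuousOn_s y t)
  · exact aestronglyMeasurable_uIoc_of_continuousOn ht.le (h'.continuousOn_s x t)
  · filter_upwards [ae_mem_Ioo_of_mem_uIoc ht.le] with s hs hs' y _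
    exact hC y t s (hs hs').1 (hs hs').2 le_rfl
  · exact (intervalIntegrable_beta h'.a_lt h'.b_lt ht).const_mul _
  · filter_upwards [ae_mem_Ioo_of_mem_uIoc ht.le] with s hs hs' y _
    exact hd y t s (hs hs').1 (hs hs').2

/-- Fubini on the triangle `0 < s < τ < t`. The inner integral of `|K|` is of order `τ^(1 - a - b)`,
which is integrable at zero because `a + b < 2`. -/
lemma integral_integral_swap (h : SingularKernel K a b) (hab : a + b < 2) (x : ℝ) {t : ℝ}
    (ht : 0 < t) :
    ∫ s in (0:ℝ)..t, ∫ τ in s..t, K x τ s = ∫ τ in (0:ℝ)..t, ∫ s in (0:ℝ)..τ, K x τ s := by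
  obtain ⟨C, hC0, hC⟩ := h.bound t ht
  set D : Set (ℝ × ℝ) := {q | 0 < q.2 ∧ q.2 < q.1 ∧ q.1 < t} with hD
  have hDo : IsOpen D := by
    have h1 : IsOpen {q : ℝ × ℝ | 0 < q.2} := isOpen_lt continuous_const (by fun_prop)
    have h2 : IsOpen {q : ℝ × ℝ | q.2 < q.1} := isOpen_lt (by fun_prop) (by fun_prop)
    have h3 : IsOpen {q : ℝ × ℝ | q.1 < t} := isOpen_lt (by fun_prop) continuous_const
    exact h1.inter (h2.inter h3)
  set F : ℝ × ℝ → ℝ := D.indicator fun q => K x q.1 q.2 with hF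
  have hFm : AEStronglyMeasurable F (volume.prod volume) := by
    rw [hF, aestronglyMeasurable_indicator_iff hDo.measurableSet]
    refine ContinuousOn.aestronglyMeasurable ?_ hDo.measurableSet
    rintro ⟨τ, s⟩ ⟨h1, h2, -⟩
    exact (ContinuousAt.comp (x := (τ, s))
      (f := fun q : ℝ × ℝ => ((x, q.1, q.2) : ℝ × ℝ × ℝ))
      (h.continuousAt (x := x) h1 h2) (by fun_prop)).continuousWithinAt
  have hFτ : ∀ τ, 0 < τ → τ < t → (fun s => F (τ, s)) = (Ioo 0 τ).indicator fun s => K x τ s := by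
    intro τ h1 h2
    ext s
    by_cases hs : s ∈ Ioo 0 τ
    · rw [indicator_of_mem hs, hF, indicator_of_mem]
      exact ⟨hs.1, hs.2, h2⟩
    · rw [indicator_of_notMem hs, hF, indicator_of_notMem]
      exact fun hq => hs ⟨hq.1, hq.2.1⟩
  have hFτ0 : ∀ τ, ¬ (0 < τ ∧ τ < t) → (fun s => F (τ, s)) = fun _ => 0 := by
    intro τ hτ
    ext s
    rw [hF, indicator_of_notMem]
    exact fun hq => hτ ⟨hq.1.trans hq.2.1, hq.2.2⟩
  have hFs : ∀ s, 0 < s → s < t → (fun τ => F (τ, s)) = (Ioo s t).indicator fun τ => K x τ s := by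
    intro s h1 h2
    ext τ
    by_cases hs : τ ∈ Ioo s t
    · rw [indicator_of_mem hs, hF, indicator_of_mem]
      exact ⟨h1, hs.1, hs.2⟩
    · rw [indicator_of_notMem hs, hF, indicator_of_notMem]
      exact fun hq => hs ⟨hq.2.1, hq.2.2⟩
  have hFs0 : ∀ s, ¬ (0 < s ∧ s < t) → (fun τ => F (τ, s)) = fun _ => 0 := by
    intro s hs
    ext τ
    rw [hF, indicator_of_notMem]
    exact fun hq => hs ⟨hq.1, hq.2.1.trans hq.2.2⟩
  have hint : Integrable F (volume.prod volume) := by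
    rw [integrable_prod_iff hFm]
    constructor
    · refine Eventually.of_forall fun τ => ?_
      by_cases hτ : 0 < τ ∧ τ < t
      · rw [hFτ τ hτ.1 hτ.2, integrable_indicator_iff measurableSet_Ioo]
        have := h.intervalIntegrable x hτ.1
        rw [intervalIntegrable_iff_integrableOn_Ioo_of_le hτ.1.le] at this
        exact this
      · rw [hFτ0 τ hτ]; exact integrable_zero _ _ _
    · have hb : Integrable ((Ioo 0 t).indicator
          fun τ => C * (τ ^ (1 - a - b) * betaInt a b)) := by
        rw [integrable_indicator_iff measurableSet_Ioo,
          ← intervalIntegrable_iff_integrableOn_Ioo_of_le ht.le]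
        exact ((intervalIntegral.intervalIntegrable_rpow' (by linarith)).mul_const _).const_mul _
      refine hb.mono' hFm.norm.integral_prod_right' (Eventually.of_forall fun τ => ?_)
      rw [Real.norm_of_nonneg (integral_nonneg fun _ => norm_nonneg _)]
      by_cases hτ : 0 < τ ∧ τ < t
      · rw [indicator_of_mem (show τ ∈ Ioo 0 t from hτ)]
        have e : (fun s => ‖F (τ, s)‖) = (Ioo 0 τ).indicator fun s => |K x τ s| := by
          ext s
          rw [show F (τ, s) = _ from congrFun (hFτ τ hτ.1 hτ.2) s, norm_indicator_eq_indicator_norm]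
          rfl
        rw [e, integral_indicator measurableSet_Ioo, ← integral_Ioc_eq_integral_Ioo,
          ← intervalIntegral.integral_of_le hτ.1.le]
        refine (le_abs_self _).trans (abs_integral_le_beta h.a_lt h.b_lt hτ.1 fun s h1 h2 => ?_)
        rw [abs_abs]
        exact hC x τ s h1 h2 hτ.2.le
      · rw [indicator_of_notMem (show τ ∉ Ioo 0 t from hτ)]
        have e : (fun s => ‖F (τ, s)‖) = fun _ => 0 := by
          ext s
          rw [show F (τ, s) = _ from congrFun (hFτ0 τ hτ) s, norm_zero]
        rw [e]; simp
  have hsw := MeasureTheory.integral_integral_swap (f := fun τ s => F (τ, s)) hint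
  have e1 : ∫ τ, ∫ s, F (τ, s) = ∫ τ in (0:ℝ)..t, ∫ s in (0:ℝ)..τ, K x τ s := by
    rw [intervalIntegral.integral_of_le ht.le, integral_Ioc_eq_integral_Ioo,
      ← integral_indicator measurableSet_Ioo]
    congr 1; ext τ
    by_cases hτ : 0 < τ ∧ τ < t
    · rw [indicator_of_mem (show τ ∈ Ioo 0 t from hτ), hFτ τ hτ.1 hτ.2,
        integral_indicator measurableSet_Ioo, ← integral_Ioc_eq_integral_Ioo,
        ← intervalIntegral.integral_of_le hτ.1.le]
    · rw [indicator_of_notMem (show τ ∉ Ioo 0 t from hτ), hFτ0 τ hτ, integral_zero]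
  have e2 : ∫ s, ∫ τ, F (τ, s) = ∫ s in (0:ℝ)..t, ∫ τ in s..t, K x τ s := by
    rw [intervalIntegral.integral_of_le ht.le, integral_Ioc_eq_integral_Ioo,
      ← integral_indicator measurableSet_Ioo]
    congr 1; ext s
    by_cases hs : 0 < s ∧ s < t
    · rw [indicator_of_mem (show s ∈ Ioo 0 t from hs), hFs s hs.1 hs.2,
        integral_indicator measurableSet_Ioo, ← integral_Ioc_eq_integral_Ioo,
        ← intervalIntegral.integral_of_le hs.2.le]
    · rw [indicator_of_notMem (show s ∉ Ioo 0 t from hs), hFs0 s hs, integral_zero]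
  rw [← e1, ← e2, hsw]

end SingularKernel

/-! ### Duhamel integrals and their derivatives. -/

/-- The integrand `(t - s)^(-a) ∫ k(z) f(x - √(t - s) z, s) dz` of a Duhamel integral. -/
def duhamelKernel (k : ℝ → ℝ) (a : ℝ) (f : ℝ → ℝ → ℝ) (x t s : ℝ) : ℝ :=
  (t - s) ^ (-a) * smooth k (t - s) (fun y => f y s) x

/-- The Duhamel integral with kernel `duhamelKernel`. -/
def duhamel (k : ℝ → ℝ) (a : ℝ) (f : ℝ → ℝ → ℝ) (x t : ℝ) : ℝ :=
  ∫ s in (0:ℝ)..t, duhamelKernel k a f x t s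

/-- A continuous source term with an integrable singularity at time zero. -/
structure IsSource (f : ℝ → ℝ → ℝ) (A : ℝ) : Prop where
  cont : ContinuousOn (fun p : ℝ × ℝ => f p.1 p.2) domain
  bound : ∀ x s, 0 < s → |f x s| ≤ A * s ^ (-(1 / 2) : ℝ)

/-- A source term which is Hölder continuous in space of exponent `1/2`. -/
def IsHolderSource (f : ℝ → ℝ → ℝ) : Prop :=
  ∀ T, 0 < T → ∃ H, 0 ≤ H ∧ ∀ x y s, 0 < s → s ≤ T →
    |f x s - f y s| ≤ H * s ^ (-(3 / 4) : ℝ) * Real.sqrt |x - y|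

lemma mem_domain {x t : ℝ} : (x, t) ∈ domain ↔ 0 < t := by simp [domain]

namespace IsSource

variable {f : ℝ → ℝ → ℝ} {A : ℝ} {k k' : ℝ → ℝ} {C C' : ℝ}

lemma nonneg (hf : IsSource f A) : 0 ≤ A := by
  have := (abs_nonneg _).trans (hf.bound 0 1 one_pos)
  simpa using this

lemma continuousAt (hf : IsSource f A) (x : ℝ) {s : ℝ} (hs : 0 < s) :
    ContinuousAt (fun p : ℝ × ℝ => f p.1 p.2) (x, s) :=
  hf.cont.continuousAt (isOpen_domain.mem_nhds (mem_domain.2 hs))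

lemma continuous_slice (hf : IsSource f A) {s : ℝ} (hs : 0 < s) :
    Continuous (fun y => f y s) :=
  continuous_iff_continuousAt.2 fun x => ContinuousAt.comp (x := x)
    (f := fun y : ℝ => ((y, s) : ℝ × ℝ)) (hf.continuousAt x hs) (by fun_prop)

lemma continuousAt_smooth (hf : IsSource f A) (hk : GaussBound k C) {x τ s : ℝ} (hs : 0 < s) :
    ContinuousAt (fun q : ℝ × ℝ × ℝ => smooth k q.2.1 (fun y => f y q.2.2) q.1) (x, τ, s) := by
  have hA := hf.nonneg
  have hnear : ∀ᶠ q : ℝ × ℝ × ℝ in 𝓝 (x, τ, s), s / 2 < q.2.2 := by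
    have : ContinuousAt (fun q : ℝ × ℝ × ℝ => q.2.2) (x, τ, s) := by fun_prop
    exact this.eventually (lt_mem_nhds (by simp; linarith))
  unfold smooth
  refine continuousAt_of_dominated
    (bound := fun z => |k z| * (A * (s / 2) ^ (-(1 / 2) : ℝ))) ?_ ?_
    (hk.integrable_abs.mul_const _) ?_
  · filter_upwards [hnear] with q hq
    have h1 := hf.continuous_slice (show 0 < q.2.2 by linarith)
    have h2 := hk.cont
    exact (h2.mul (h1.comp (by fun_prop))).aestronglyMeasurable
  · filter_upwards [hnear] with q hq
    refine Eventually.of_forall fun z => ?_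
    rw [Real.norm_eq_abs, abs_mul]
    refine mul_le_mul_of_nonneg_left ((hf.bound _ _ (by linarith)).trans ?_) (abs_nonneg _)
    exact mul_le_mul_of_nonneg_left
      (Real.rpow_le_rpow_of_nonpos (by linarith) hq.le (by norm_num)) hA
  · refine Eventually.of_forall fun z => continuousAt_const.mul ?_
    exact ContinuousAt.comp (x := (x, τ, s))
      (f := fun q : ℝ × ℝ × ℝ => ((q.1 - Real.sqrt q.2.1 * z, q.2.2) : ℝ × ℝ))
      (hf.continuousAt _ hs) (by fun_prop)

lemma continuousOn_duhamelKernel (hf : IsSource f A) (hk : GaussBound k C) (a : ℝ) :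
    ContinuousOn (fun q : ℝ × ℝ × ℝ => duhamelKernel k a f q.1 q.2.1 q.2.2)
      {q | 0 < q.2.2 ∧ q.2.2 < q.2.1} := by
  rintro ⟨x, t, s⟩ ⟨hs, hst⟩
  have hst : s < t := hst
  refine ContinuousAt.continuousWithinAt (ContinuousAt.mul ?_ ?_)
  · exact ContinuousAt.rpow_const (by fun_prop) (Or.inl (by simp; linarith))
  · exact ContinuousAt.comp (x := (x, t, s))
      (f := fun q : ℝ × ℝ × ℝ => ((q.1, q.2.1 - q.2.2, q.2.2) : ℝ × ℝ × ℝ))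
      (hf.continuousAt_smooth hk hs) (by fun_prop)

lemma abs_duhamelKernel_le (hf : IsSource f A) (hk : GaussBound k C) (a : ℝ) (x : ℝ) {t s : ℝ}
    (hs : 0 < s) (hst : s < t) :
    |duhamelKernel k a f x t s| ≤
      (∫ z, |k z|) * A * ((t - s) ^ (-a) * s ^ (-(1 / 2) : ℝ)) := by
  have h0 : 0 ≤ (t - s) ^ (-a) := Real.rpow_nonneg (by linarith) _
  rw [duhamelKernel, abs_mul, abs_of_nonneg h0]
  have := abs_smooth_le hk (fun y => hf.bound y s hs) (t - s) x
  calc _ ≤ (t - s) ^ (-a) * ((∫ z, |k z|) * (A * s ^ (-(1 / 2) : ℝ))) := by gcongr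
    _ = _ := by ring

lemma singularKernel (hf : IsSource f A) (hk : GaussBound k C) {a : ℝ} (h0 : 0 ≤ a)
    (h1 : a < 1) : SingularKernel (duhamelKernel k a f) a (1 / 2) where
  a_nonneg := h0
  a_lt := h1
  b_nonneg := by norm_num
  b_lt := by norm_num
  cont := hf.continuousOn_duhamelKernel hk a
  bound T _ := ⟨(∫ z, |k z|) * A,
    mul_nonneg (integral_nonneg fun _ => abs_nonneg _) hf.nonneg,
    fun x _ _ hs hst _ => hf.abs_duhamelKernel_le hk a x hs hst⟩

/-- The gain `(t - s)^(1/4)` from the mean-zero kernel turns the non-integrable `(t - s)^(-1)` into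
`(t - s)^(-3/4)`. -/
lemma abs_duhamelKernel_le_of_holder (hf : IsSource f A) (hk : GaussBound k C)
    (hk0 : ∫ z, k z = 0) {H : ℝ} (x : ℝ) {t s : ℝ} (hs : 0 < s) (hst : s < t)
    (hH : ∀ x y, |f x s - f y s| ≤ H * s ^ (-(3 / 4) : ℝ) * Real.sqrt |x - y|) :
    |duhamelKernel k 1 f x t s| ≤
      (∫ z, |k z| * Real.sqrt |z|) * H * ((t - s) ^ (-(3 / 4) : ℝ) * s ^ (-(3 / 4) : ℝ)) := by
  have hts : 0 < t - s := by linarith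
  have h0 : 0 ≤ (t - s) ^ (-1 : ℝ) := Real.rpow_nonneg hts.le _
  rw [duhamelKernel, abs_mul, abs_of_nonneg h0]
  have := abs_smooth_le_of_holder hk hk0 (hf.continuous_slice hs).measurable
    (fun y => hf.bound y s hs) hH (t - s) x
  have e : (t - s) ^ (-(3 / 4) : ℝ) = (t - s) ^ (-1 : ℝ) * Real.sqrt (Real.sqrt (t - s)) := by
    rw [Real.sqrt_eq_rpow, Real.sqrt_eq_rpow, ← Real.rpow_mul hts.le, ← Real.rpow_add hts]
    norm_num
  calc _ ≤ (t - s) ^ (-1 : ℝ) * ((∫ z, |k z| * Real.sqrt |z|) *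
        (H * s ^ (-(3 / 4) : ℝ) * Real.sqrt (Real.sqrt (t - s)))) := by gcongr
    _ = _ := by rw [e]; ring

lemma singularKernel_of_holder (hf : IsSource f A) (hH : IsHolderSource f)
    (hk : GaussBound k C) (hk0 : ∫ z, k z = 0) :
    SingularKernel (duhamelKernel k 1 f) (3 / 4) (3 / 4) where
  a_nonneg := by norm_num
  a_lt := by norm_num
  b_nonneg := by norm_num
  b_lt := by norm_num
  cont := hf.continuousOn_duhamelKernel hk 1
  bound T hT := by
    obtain ⟨H, hH0, h⟩ := hH T hT
    exact ⟨(∫ z, |k z| * Real.sqrt |z|) * H,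
      mul_nonneg (integral_nonneg fun _ => by positivity) hH0,
      fun x t s hs hst ht => hf.abs_duhamelKernel_le_of_holder hk hk0 x hs hst
        fun x y => h x y s hs (by linarith)⟩

/-- Each space derivative costs a factor `(t - s)^(-1/2)`, hence the shift of the exponent. -/
lemma hasDerivAt_duhamelKernel (hf : IsSource f A) (hk : GaussBound k C) (hk' : GaussBound k' C')
    (hd : ∀ z, HasDerivAt k (k' z) z) {a a' : ℝ} (ha : a' = a + 1 / 2) (x t s : ℝ) (hs : 0 < s)
    (hst : s < t) :
    HasDerivAt (fun x => duhamelKernel k a f x t s) (duhamelKernel k' a' f x t s) x := by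
  have hts : 0 < t - s := by linarith
  have := (hasDerivAt_smooth_x hk hk' hd (hf.continuous_slice hs).measurable
    (fun y => hf.bound y s hs) hts x).const_mul ((t - s) ^ (-a))
  refine this.congr_deriv ?_
  rw [duhamelKernel, ha, neg_add, Real.rpow_add hts, Real.sqrt_eq_rpow, Real.rpow_neg hts.le (1 / 2)]
  ring

lemma hasDerivAt_duhamel_x (hf : IsSource f A) (x : ℝ) {t : ℝ} (ht : 0 < t) :
    HasDerivAt (fun x => duhamel gauss0 0 f x t) (duhamel gauss1 (1 / 2) f x t) x :=
  (hf.singularKernel gaussBound0 le_rfl one_pos).hasDerivAt_integral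
    (hf.singularKernel gaussBound1 (by norm_num) (by norm_num))
    (hf.hasDerivAt_duhamelKernel gaussBound0 gaussBound1 hasDerivAt_gauss0 (by norm_num)) x ht

lemma hasDerivAt_duhamel_xx (hf : IsSource f A) (hH : IsHolderSource f) (x : ℝ) {t : ℝ}
    (ht : 0 < t) :
    HasDerivAt (fun x => duhamel gauss1 (1 / 2) f x t) (duhamel gauss2 1 f x t) x :=
  (hf.singularKernel gaussBound1 (by norm_num) (by norm_num)).hasDerivAt_integral
    (hf.singularKernel_of_holder hH gaussBound2 integral_gauss2)
    (hf.hasDerivAt_duhamelKernel gaussBound1 gaussBound2 hasDerivAt_gauss1 (by norm_num)) x ht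

/-- The fundamental theorem of calculus along the heat flow started at time `s` from `f(·, s)`. At
`τ = s` the average collapses to `f x s`, because `gauss0` has mass one. -/
lemma smooth_eq_add_integral (hf : IsSource f A) (hH : IsHolderSource f) (x : ℝ) {t s : ℝ}
    (hs : 0 < s) (hst : s < t) :
    duhamelKernel gauss0 0 f x t s = f x s + ∫ τ in s..t, duhamelKernel gauss2 1 f x τ s := by
  have hm := (hf.continuous_slice hs).measurable
  have hb := fun y => hf.bound y s hs
  have hcont : ContinuousOn (fun τ => smooth gauss0 (τ - s) (fun y => f y s) x) (Icc s t) := by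
    intro τ _
    exact (ContinuousAt.comp (x := τ) (f := fun τ : ℝ => ((x, τ - s, s) : ℝ × ℝ × ℝ))
      (hf.continuousAt_smooth gaussBound0 hs) (by fun_prop)).continuousWithinAt
  have hder : ∀ τ ∈ Ioo s t, HasDerivAt (fun τ => smooth gauss0 (τ - s) (fun y => f y s) x)
      (duhamelKernel gauss2 1 f x τ s) τ := by
    intro τ hτ
    have h1 : 0 < τ - s := by linarith [hτ.1]
    have := (hasDerivAt_smooth_t hm hb h1 x).comp τ ((hasDerivAt_id τ).sub_const s)
    refine this.congr_deriv ?_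
    rw [duhamelKernel, Real.rpow_neg_one, mul_one]
  have hint : IntervalIntegrable (fun τ => duhamelKernel gauss2 1 f x τ s) volume s t := by
    obtain ⟨H, hH0, h⟩ := hH t (by linarith)
    have hg : IntervalIntegrable (fun τ => (∫ z, |gauss2 z| * Real.sqrt |z|) * H *
        ((τ - s) ^ (-(3 / 4) : ℝ) * s ^ (-(3 / 4) : ℝ))) volume s t := by
      have := (intervalIntegral.intervalIntegrable_rpow' (a := 0) (b := t - s) (r := -(3 / 4))
        (by norm_num)).comp_sub_right s
      rw [zero_add, sub_add_cancel] at this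
      exact (this.mul_const _).const_mul _
    refine hg.mono_fun' (aestronglyMeasurable_uIoc_of_continuousOn hst.le ?_) ?_
    · intro τ hτ
      exact (ContinuousAt.comp (x := τ) (f := fun τ : ℝ => ((x, τ, s) : ℝ × ℝ × ℝ))
        ((hf.continuousOn_duhamelKernel gaussBound2 1).continuousAt
          (isOpen_triangle.mem_nhds ⟨hs, hτ.1⟩)) (by fun_prop)).continuousWithinAt
    · rw [EventuallyLE, ae_restrict_iff' measurableSet_uIoc]
      filter_upwards [ae_mem_Ioo_of_mem_uIoc hst.le] with τ hτ hτ'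
      exact hf.abs_duhamelKernel_le_of_holder gaussBound2 integral_gauss2 x hs (hτ hτ').1
        fun x y => h x y s hs hst.le
  have := intervalIntegral.integral_eq_sub_of_hasDerivAt_of_le hst.le hcont hder hint
  rw [this]
  have e : smooth gauss0 (s - s) (fun y => f y s) x = f x s := by
    rw [smooth]
    simp only [sub_self, Real.sqrt_zero, zero_mul, sub_zero]
    rw [integral_mul_const, integral_gauss0, one_mul]
  rw [e, duhamelKernel, neg_zero, Real.rpow_zero]
  ring

lemma intervalIntegrable (hf : IsSource f A) (x : ℝ) {t : ℝ} (ht : 0 < t) :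
    IntervalIntegrable (fun s => f x s) volume 0 t := by
  have hg : IntervalIntegrable (fun s => A * s ^ (-(1 / 2) : ℝ)) volume 0 t :=
    (intervalIntegral.intervalIntegrable_rpow' (by norm_num)).const_mul _
  refine hg.mono_fun' (aestronglyMeasurable_uIoc_of_continuousOn ht.le ?_) ?_
  · intro s hs
    exact (ContinuousAt.comp (x := s) (f := fun s : ℝ => ((x, s) : ℝ × ℝ))
      (hf.continuousAt x hs.1) (by fun_prop)).continuousWithinAt
  · rw [EventuallyLE, ae_restrict_iff' measurableSet_uIoc]
    filter_upwards [ae_mem_Ioo_of_mem_uIoc ht.le] with s h h'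
    exact hf.bound x s (h h').1

/-- Direct differentiation would meet the moving singular endpoint `s = t`. Instead
`smooth_eq_add_integral` and Fubini write the Duhamel integral as the time integral of a function
continuous on `(0, ∞)`, to which the fundamental theorem of calculus applies. -/
lemma hasDerivAt_duhamel_t (hf : IsSource f A) (hH : IsHolderSource f) (x : ℝ) {t : ℝ}
    (ht : 0 < t) :
    HasDerivAt (fun t => duhamel gauss0 0 f x t) (duhamel gauss2 1 f x t + f x t) t := by
  have hK := hf.singularKernel_of_holder hH gaussBound2 integral_gauss2
  have hcont : ContinuousOn (fun τ => duhamel gauss2 1 f x τ + f x τ) (Ioi 0) := by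
    intro τ hτ
    have h1 := hK.continuousOn_integral.continuousAt
      (isOpen_domain.mem_nhds (mem_domain.2 hτ : (x, τ) ∈ domain))
    exact ((ContinuousAt.comp (x := τ) (f := fun τ : ℝ => ((x, τ) : ℝ × ℝ)) h1
      (by fun_prop)).add (ContinuousAt.comp (x := τ) (f := fun s : ℝ => ((x, s) : ℝ × ℝ))
      (hf.continuousAt x hτ) (by fun_prop))).continuousWithinAt
  have hint1 : ∀ t, 0 < t → IntervalIntegrable (fun τ => duhamel gauss2 1 f x τ) volume 0 t := by
    intro t ht
    obtain ⟨C, hC0, hC⟩ := hK.bound t ht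
    have hg : IntervalIntegrable (fun τ : ℝ => C * (τ ^ (1 - 3 / 4 - 3 / 4 : ℝ) *
        betaInt (3 / 4) (3 / 4))) volume 0 t :=
      ((intervalIntegral.intervalIntegrable_rpow' (by norm_num)).mul_const _).const_mul _
    refine hg.mono_fun' (aestronglyMeasurable_uIoc_of_continuousOn ht.le ?_) ?_
    · intro τ hτ
      have h1 := hK.continuousOn_integral.continuousAt
        (isOpen_domain.mem_nhds (mem_domain.2 hτ.1 : (x, τ) ∈ domain))
      exact (ContinuousAt.comp (x := τ) (f := fun τ : ℝ => ((x, τ) : ℝ × ℝ)) h1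
        (by fun_prop)).continuousWithinAt
    · rw [EventuallyLE, ae_restrict_iff' measurableSet_uIoc]
      filter_upwards [ae_mem_Ioo_of_mem_uIoc ht.le] with τ h h'
      exact abs_integral_le_beta (by norm_num) (by norm_num) (h h').1
        fun s h1 h2 => hC x τ s h1 h2 (h h').2.le
  have hint2 : ∀ t, 0 < t → IntervalIntegrable (fun τ => f x τ) volume 0 t :=
    fun t ht => hf.intervalIntegrable x ht
  have key : ∀ t, 0 < t → duhamel gauss0 0 f x t =
      ∫ τ in (0:ℝ)..t, (duhamel gauss2 1 f x τ + f x τ) := by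
    intro t ht
    rw [intervalIntegral.integral_add (hint1 t ht) (hint2 t ht)]
    unfold duhamel
    rw [← hK.integral_integral_swap (by norm_num) x ht, ← sub_eq_iff_eq_add]
    have h0 := (hf.singularKernel gaussBound0 le_rfl one_pos).intervalIntegrable x ht
    rw [← intervalIntegral.integral_sub h0 (hint2 t ht)]
    refine intervalIntegral.integral_congr_ae ?_
    filter_upwards [ae_mem_Ioo_of_mem_uIoc ht.le] with s h h'
    rw [hf.smooth_eq_add_integral hH x (h h').1 (h h').2]
    ring
  have hd := intervalIntegral.integral_hasDerivAt_right ((hint1 t ht).add (hint2 t ht))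
    (hcont.stronglyMeasurableAtFilter isOpen_Ioi t ht) (hcont.continuousAt (Ioi_mem_nhds ht))
  refine hd.congr_of_eventuallyEq ?_
  filter_upwards [Ioi_mem_nhds ht] with t ht using key t ht

end IsSource

/-! ### Classical regularity of mild solutions. -/

/-- `C^{2,1}` regularity from explicit derivatives. -/
lemma isC21_of_hasDerivAt {u ux uxx ut : ℝ → ℝ → ℝ}
    (hx : ∀ x t, 0 < t → HasDerivAt (fun y => u y t) (ux x t) x)
    (hxx : ∀ x t, 0 < t → HasDerivAt (fun y => ux y t) (uxx x t) x)
    (ht : ∀ x t, 0 < t → HasDerivAt (fun s => u x s) (ut x t) t)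
    (c : ContinuousOn (fun p : ℝ × ℝ => u p.1 p.2) domain)
    (cx : ContinuousOn (fun p : ℝ × ℝ => ux p.1 p.2) domain)
    (cxx : ContinuousOn (fun p : ℝ × ℝ => uxx p.1 p.2) domain)
    (ct : ContinuousOn (fun p : ℝ × ℝ => ut p.1 p.2) domain) :
    IsC21 u ∧ ∀ x t, 0 < t → dx u x t = ux x t ∧ dx (dx u) x t = uxx x t ∧ dt u x t = ut x t := by
  have e1 : ∀ x t, 0 < t → dx u x t = ux x t := fun x t h => (hx x t h).deriv
  have e1' : ∀ t, 0 < t → (fun y => dx u y t) = fun y => ux y t :=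
    fun t h => funext fun y => e1 y t h
  have e2 : ∀ x t, 0 < t → dx (dx u) x t = uxx x t := by
    intro x t h
    rw [dx, e1' t h]
    exact (hxx x t h).deriv
  have e3 : ∀ x t, 0 < t → dt u x t = ut x t := fun x t h => (ht x t h).deriv
  refine ⟨⟨fun x t h => (hx x t h).differentiableAt, fun x t h => ?_,
    fun x t h => (ht x t h).differentiableAt, c, ?_, ?_, ?_⟩,
    fun x t h => ⟨e1 x t h, e2 x t h, e3 x t h⟩⟩
  · rw [e1' t h]
    exact (hxx x t h).differentiableAt
  · exact cx.congr fun p hp => e1 _ _ hp.2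
  · exact cxx.congr fun p hp => e2 _ _ hp.2
  · exact ct.congr fun p hp => e3 _ _ hp.2

lemma continuousOn_smooth {k : ℝ → ℝ} {C : ℝ} (h : GaussBound k C) {g : ℝ → ℝ} {A : ℝ}
    (hm : Measurable g) (hg : ∀ x, |g x| ≤ A) :
    ContinuousOn (fun p : ℝ × ℝ => smooth k p.2 g p.1) domain := fun p hp =>
  (continuousAt_smooth h hm hg p.1 hp.2).continuousWithinAt

/-- The mild solution of `u_t = u_xx - f` with initial data `g`. -/
def mild (g : ℝ → ℝ) (f : ℝ → ℝ → ℝ) (x t : ℝ) : ℝ :=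
  smooth gauss0 t g x - duhamel gauss0 0 f x t

/-- The space derivative of `mild g f`. -/
def mildX (g : ℝ → ℝ) (f : ℝ → ℝ → ℝ) (x t : ℝ) : ℝ :=
  (Real.sqrt t)⁻¹ * smooth gauss1 t g x - duhamel gauss1 (1 / 2) f x t

section mild

variable {g : ℝ → ℝ} {M : ℝ} {f : ℝ → ℝ → ℝ} {A : ℝ}

lemma hasDerivAt_mild (hm : Measurable g) (hg : ∀ x, |g x| ≤ M) (hf : IsSource f A) (x : ℝ)
    {t : ℝ} (ht : 0 < t) : HasDerivAt (fun x => mild g f x t) (mildX g f x t) x :=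
  (hasDerivAt_smooth_x gaussBound0 gaussBound1 hasDerivAt_gauss0 hm hg ht x).sub
    (hf.hasDerivAt_duhamel_x x ht)

lemma continuousOn_mild (hm : Measurable g) (hg : ∀ x, |g x| ≤ M) (hf : IsSource f A) :
    ContinuousOn (fun p : ℝ × ℝ => mild g f p.1 p.2) domain :=
  (continuousOn_smooth gaussBound0 hm hg).sub
    (hf.singularKernel gaussBound0 le_rfl one_pos).continuousOn_integral

lemma continuousOn_inv_sqrt : ContinuousOn (fun p : ℝ × ℝ => (Real.sqrt p.2)⁻¹) domain :=
  ContinuousOn.inv₀ (by fun_prop) fun p hp => (Real.sqrt_pos.2 hp.2).ne'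

lemma continuousOn_mildX (hm : Measurable g) (hg : ∀ x, |g x| ≤ M) (hf : IsSource f A) :
    ContinuousOn (fun p : ℝ × ℝ => mildX g f p.1 p.2) domain :=
  (continuousOn_inv_sqrt.mul (continuousOn_smooth gaussBound1 hm hg)).sub
    (hf.singularKernel gaussBound1 (by norm_num) (by norm_num)).continuousOn_integral

lemma isC21_mild (hm : Measurable g) (hg : ∀ x, |g x| ≤ M) (hf : IsSource f A)
    (hH : IsHolderSource f) :
    IsC21 (mild g f) ∧ ∀ x t, 0 < t → dx (mild g f) x t = mildX g f x t ∧
      dt (mild g f) x t = dx (dx (mild g f)) x t - f x t := by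
  have hK := hf.singularKernel_of_holder hH gaussBound2 integral_gauss2
  have ci : ContinuousOn (fun p : ℝ × ℝ => p.2⁻¹) domain :=
    ContinuousOn.inv₀ (by fun_prop) fun p hp => (show (0:ℝ) < p.2 from hp.2).ne'
  have c2 : ContinuousOn (fun p : ℝ × ℝ => p.2⁻¹ * smooth gauss2 p.2 g p.1 -
      duhamel gauss2 1 f p.1 p.2) domain :=
    (ci.mul (continuousOn_smooth gaussBound2 hm hg)).sub hK.continuousOn_integral
  obtain ⟨h1, h2⟩ := isC21_of_hasDerivAt (u := mild g f) (ux := mildX g f)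
    (uxx := fun x t => t⁻¹ * smooth gauss2 t g x - duhamel gauss2 1 f x t)
    (ut := fun x t => t⁻¹ * smooth gauss2 t g x - (duhamel gauss2 1 f x t + f x t))
    (fun x t ht => hasDerivAt_mild hm hg hf x ht)
    (fun x t ht => by
      have h1 := ((hasDerivAt_smooth_x gaussBound1 gaussBound2 hasDerivAt_gauss1 hm hg ht
        x).const_mul (Real.sqrt t)⁻¹).sub (hf.hasDerivAt_duhamel_xx hH x ht)
      refine h1.congr_deriv ?_
      rw [← mul_assoc, ← mul_inv, Real.mul_self_sqrt ht.le])
    (fun x t ht => (hasDerivAt_smooth_t hm hg ht x).sub (hf.hasDerivAt_duhamel_t hH x ht))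
    (continuousOn_mild hm hg hf) (continuousOn_mildX hm hg hf) c2
    ((c2.sub hf.cont).congr fun p hp => by simp only [Pi.sub_apply]; ring)
  refine ⟨h1, fun x t ht => ⟨(h2 x t ht).1, ?_⟩⟩
  rw [(h2 x t ht).2.1, (h2 x t ht).2.2]
  ring

end mild

/-! ### Maximum principle on the line with a singular zeroth-order term. -/

/-- If `z''` were positive, the second derivative test would make `x₀` a local minimum too. Then `z`
would be locally constant and its second derivative zero. -/
lemma second_deriv_nonpos_of_isLocalMax {z z' : ℝ → ℝ} {z'' x₀ : ℝ}
    (h1 : ∀ x, HasDerivAt z (z' x) x) (h2 : HasDerivAt z' z'' x₀) (hm : IsLocalMax z x₀) :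
    z'' ≤ 0 := by
  by_contra! hpos
  have e1 : deriv z = z' := funext fun x => (h1 x).deriv
  have e2 : deriv (deriv z) x₀ = z'' := by rw [e1]; exact h2.deriv
  have hmin := isLocalMin_of_deriv_deriv_pos (by rw [e2]; exact hpos) hm.deriv_eq_zero
    (h1 x₀).continuousAt
  have hc : z =ᶠ[𝓝 x₀] fun _ => z x₀ := by
    filter_upwards [hm, hmin] with x ha hb using le_antisymm ha hb
  have : deriv (deriv z) x₀ = 0 := by
    rw [hc.deriv.deriv_eq]; simp
  linarith

/-- Only earlier times are compared, since the maximum may sit at the final time `T`. -/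
lemma deriv_nonneg_of_left_max {f : ℝ → ℝ} {f' τ a : ℝ} (h : HasDerivAt f f' a) (hτ : τ < a)
    (hm : ∀ t, τ ≤ t → t ≤ a → f t ≤ f a) : 0 ≤ f' := by
  have h1 : Tendsto (slope f a) (𝓝[<] a) (𝓝 f') :=
    h.tendsto_slope.mono_left (nhdsWithin_mono _ fun x (hx : x < a) => hx.ne)
  refine ge_of_tendsto h1 ?_
  filter_upwards [Ioo_mem_nhdsLT hτ] with t ht
  rw [slope_def_field]
  exact div_nonneg_of_nonpos (by linarith [hm t ht.1.le ht.2.le]) (by linarith [ht.2])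

section maximum

variable {w wx wxx wt b c : ℝ → ℝ → ℝ} {T B L N : ℝ}

/-- The weight `exp (-2 L √t)` has logarithmic derivative `-L/√t`, which cancels the growth allowed
by `c`. The term `η exp ((3 + B) t) (1 + x²)` is a strict supersolution for the drift part and
forces a positive maximum of `z` into a compact set. At such a point the first and second derivative
tests contradict the differential inequality. -/
lemma maximum_principle_barrier
    (hx : ∀ x t, 0 < t → HasDerivAt (fun y => w y t) (wx x t) x)
    (hxx : ∀ x t, 0 < t → HasDerivAt (fun y => wx y t) (wxx x t) x)
    (ht : ∀ x t, 0 < t → HasDerivAt (fun s => w x s) (wt x t) t)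
    (hcont : ContinuousOn (fun p : ℝ × ℝ => w p.1 p.2) domain)
    (heq : ∀ x t, 0 < t → t ≤ T → wt x t ≤ wxx x t + b x t * wx x t + c x t * w x t)
    (hb : ∀ x t, 0 < t → t ≤ T → |b x t| ≤ B)
    (hc : ∀ x t, 0 < t → t ≤ T → c x t ≤ L / Real.sqrt t)
    (hN : ∀ x t, 0 < t → t ≤ T → w x t ≤ N)
    (hL : 0 ≤ L) {τ m η : ℝ} (hτ : 0 < τ) (hm : 0 ≤ m) (hη : 0 < η) (hini : ∀ x, w x τ ≤ m)
    {x₁ t₁ : ℝ} (h1 : τ ≤ t₁) (h2 : t₁ ≤ T) :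
    w x₁ t₁ * Real.exp (-(2 * L * Real.sqrt t₁)) ≤
      m + η * (Real.exp ((3 + B) * t₁) * (1 + x₁ ^ 2)) := by
  have hB : 0 ≤ B := (abs_nonneg _).trans (hb 0 τ hτ (h1.trans h2))
  set E : ℝ → ℝ := fun t => Real.exp (-(2 * L * Real.sqrt t)) with hE
  have hEpos : ∀ t, 0 < E t := fun t => Real.exp_pos _
  have hE1 : ∀ t, E t ≤ 1 := fun t => Real.exp_le_one_iff.2 (by
    have := Real.sqrt_nonneg t
    simp only [Left.neg_nonpos_iff]; positivity)
  set G : ℝ → ℝ := fun t => Real.exp ((3 + B) * t) with hG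
  have hGpos : ∀ t, 0 < G t := fun t => Real.exp_pos _
  have hG1 : ∀ t, 0 ≤ t → 1 ≤ G t := fun t ht => Real.one_le_exp (by positivity)
  have hwE : ∀ x t K, 0 ≤ K → w x t ≤ K → w x t * E t ≤ K := by
    intro x t K hK hw
    calc w x t * E t ≤ K * E t := mul_le_mul_of_nonneg_right hw (hEpos t).le
      _ ≤ K * 1 := mul_le_mul_of_nonneg_left (hE1 t) hK
      _ = K := mul_one K
  set z : ℝ → ℝ → ℝ := fun x t => w x t * E t - m - η * (G t * (1 + x ^ 2)) with hz
  suffices z x₁ t₁ ≤ 0 by simp only [hz] at this; linarith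
  by_contra! hpos
  -- For `|x| > R` the barrier dominates the bound `N` on `w`, because `R ≤ 1 + x²`. Hence `z ≤ 0`
  -- there.
  obtain ⟨R, hR1, hR2⟩ : ∃ R, |x₁| ≤ R ∧ max N 0 ≤ η * R := by
    refine ⟨max |x₁| (max N 0 / η), le_max_left _ _, ?_⟩
    have := le_max_right |x₁| (max N 0 / η)
    rwa [div_le_iff₀ hη, mul_comm] at this
  have hout : ∀ x t, τ ≤ t → t ≤ T → R < |x| → z x t ≤ 0 := by
    intro x t ht1 ht2 hxR
    have a1 := hwE x t (max N 0) (le_max_right _ _) ((hN x t (by linarith) ht2).trans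
      (le_max_left _ _))
    have a2 : R ≤ 1 + x ^ 2 := by nlinarith [sq_abs x, sq_nonneg (|x| - 1)]
    have a3 : 1 + x ^ 2 ≤ G t * (1 + x ^ 2) :=
      le_mul_of_one_le_left (by positivity) (hG1 t (by linarith))
    have a4 : η * R ≤ η * (G t * (1 + x ^ 2)) := mul_le_mul_of_nonneg_left (a2.trans a3) hη.le
    simp only [hz]; linarith
  have hzc : ContinuousOn (fun p : ℝ × ℝ => z p.1 p.2) (Icc (-R) R ×ˢ Icc τ T) := by
    have a1 : ContinuousOn (fun p : ℝ × ℝ => w p.1 p.2) (Icc (-R) R ×ˢ Icc τ T) :=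
      hcont.mono fun p hp => ⟨mem_univ _, lt_of_lt_of_le hτ hp.2.1⟩
    have a2 : Continuous fun p : ℝ × ℝ => E p.2 := by fun_prop
    have a3 : Continuous fun p : ℝ × ℝ => η * (G p.2 * (1 + p.1 ^ 2)) := by fun_prop
    exact ((a1.mul a2.continuousOn).sub continuousOn_const).sub a3.continuousOn
  obtain ⟨⟨x, t⟩, ⟨hxR, htT⟩, hmax⟩ := (isCompact_Icc.prod isCompact_Icc).exists_isMaxOn
    ⟨(x₁, t₁), ⟨abs_le.1 hR1, ⟨h1, h2⟩⟩⟩ hzc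
  have hzpos : 0 < z x t := hpos.trans_le (show z x₁ t₁ ≤ z x t from
    hmax (show ((x₁, t₁) : ℝ × ℝ) ∈ _ from ⟨abs_le.1 hR1, ⟨h1, h2⟩⟩))
  -- The maximum over the rectangle is a maximum over the whole strip, so it is a genuine local
  -- maximum in space even if `|x| = R`.
  have hglob : ∀ y s, τ ≤ s → s ≤ T → z y s ≤ z x t := by
    intro y s hs1 hs2
    by_cases hy : |y| ≤ R
    · exact hmax (show ((y, s) : ℝ × ℝ) ∈ _ from ⟨abs_le.1 hy, ⟨hs1, hs2⟩⟩)
    · exact (hout y s hs1 hs2 (not_le.1 hy)).trans hzpos.le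
  simp only [mem_Icc] at hxR htT
  have htne : τ < t := by
    refine lt_of_le_of_ne htT.1 fun h => ?_
    have a1 := hwE x τ m hm (hini x)
    rw [← h] at hzpos
    have : 0 ≤ η * (G τ * (1 + x ^ 2)) := by have := hGpos τ; positivity
    simp only [hz] at hzpos
    linarith
  have htp : 0 < t := hτ.trans htne
  have hsp : 0 < Real.sqrt t := Real.sqrt_pos.2 htp
  have dx1 : ∀ y, HasDerivAt (fun y => z y t) (wx y t * E t - η * (G t * (2 * y))) y := by
    intro y
    have := (((hx y t htp).mul_const (E t)).sub_const m).sub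
      ((((hasDerivAt_pow 2 y).const_add 1).const_mul (G t)).const_mul η)
    exact this.congr_deriv (by norm_num)
  have dx2 : HasDerivAt (fun y => wx y t * E t - η * (G t * (2 * y)))
      (wxx x t * E t - η * (G t * 2)) x := by
    have := ((hxx x t htp).mul_const (E t)).sub
      ((((hasDerivAt_id x).const_mul 2).const_mul (G t)).const_mul η)
    exact this.congr_deriv (by norm_num)
  have dt1 : HasDerivAt (fun s => z x s) (wt x t * E t + w x t * (E t * (-(L / Real.sqrt t))) -
      η * (G t * (3 + B) * (1 + x ^ 2))) t := by
    have a1 : HasDerivAt E (E t * (-(L / Real.sqrt t))) t := by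
      have := (((Real.hasDerivAt_sqrt htp.ne').const_mul (2 * L)).neg).exp
      refine this.congr_deriv ?_
      simp only [hE, Pi.neg_apply]
      field_simp
    have a2 : HasDerivAt G (G t * (3 + B)) t := by
      have := ((hasDerivAt_id t).const_mul (3 + B)).exp
      exact this.congr_deriv (by simp [hG])
    exact (((ht x t htp).mul a1).sub_const m).sub ((a2.mul_const (1 + x ^ 2)).const_mul η)
  have hlm : IsLocalMax (fun y => z y t) x :=
    Eventually.of_forall fun y => hglob y t htT.1 htT.2
  have k1 := hlm.hasDerivAt_eq_zero (dx1 x)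
  have k2 := second_deriv_nonpos_of_isLocalMax dx1 dx2 hlm
  have k3 := deriv_nonneg_of_left_max dt1 htne fun s hs1 hs2 => hglob x s hs1 (hs2.trans htT.2)
  have hwpos : 0 < w x t * E t := by
    have : 0 ≤ η * (G t * (1 + x ^ 2)) := by have := hGpos t; positivity
    simp only [hz] at hzpos
    linarith
  have q1 := mul_le_mul_of_nonneg_right (heq x t htp htT.2) (hEpos t).le
  have q2 := mul_le_mul_of_nonneg_right (hc x t htp htT.2) hwpos.le
  have q3 : b x t * (2 * x) ≤ B * (2 * |x|) := by
    refine (le_abs_self _).trans ?_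
    rw [abs_mul, abs_mul, abs_two]
    exact mul_le_mul_of_nonneg_right (hb x t htp htT.2) (by positivity)
  -- Since `2 |x| ≤ 1 + x²`, the rate `B` pays for the drift, and 3 pays strictly for the second
  -- derivative 2 of `x²`.
  have q4 : b x t * (2 * x) + 2 < (3 + B) * (1 + x ^ 2) := by
    nlinarith [sq_abs x, sq_nonneg (|x| - 1)]
  have hηG : 0 < η * G t := mul_pos hη (hGpos t)
  have q5 := mul_lt_mul_of_pos_left q4 hηG
  have q6 : wx x t * E t = η * (G t * (2 * x)) := by linarith
  have q7 : b x t * wx x t * E t = η * G t * (b x t * (2 * x)) := by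
    rw [mul_assoc, q6]; ring
  have q8 : c x t * w x t * E t ≤ L / Real.sqrt t * (w x t * E t) := by
    rw [mul_assoc]; exact q2
  generalize L / Real.sqrt t = r at k3 q8
  linarith [k3, q1, q8, k2, q5, q7]

/-- Obtained from `maximum_principle_barrier` started at time `τ` with `m = δ + C √τ`, letting `η →
0` and afterwards `τ → 0`. -/
lemma maximum_principle
    (hx : ∀ x t, 0 < t → HasDerivAt (fun y => w y t) (wx x t) x)
    (hxx : ∀ x t, 0 < t → HasDerivAt (fun y => wx y t) (wxx x t) x)
    (ht : ∀ x t, 0 < t → HasDerivAt (fun s => w x s) (wt x t) t)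
    (hcont : ContinuousOn (fun p : ℝ × ℝ => w p.1 p.2) domain)
    (heq : ∀ x t, 0 < t → t ≤ T → wt x t ≤ wxx x t + b x t * wx x t + c x t * w x t)
    (hb : ∀ x t, 0 < t → t ≤ T → |b x t| ≤ B)
    (hc : ∀ x t, 0 < t → t ≤ T → c x t ≤ L / Real.sqrt t)
    (hN : ∀ x t, 0 < t → t ≤ T → w x t ≤ N)
    (hL : 0 ≤ L) {δ C t₀ : ℝ} (hδ : 0 ≤ δ) (hC : 0 ≤ C) (ht₀ : 0 < t₀)
    (hini : ∀ x t, 0 < t → t < t₀ → w x t ≤ δ + C * Real.sqrt t)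
    {x t : ℝ} (h1 : 0 < t) (h2 : t ≤ T) :
    w x t ≤ δ * Real.exp (2 * L * Real.sqrt t) := by
  have key : w x t * Real.exp (-(2 * L * Real.sqrt t)) ≤ δ := by
    have k1 : ∀ τ, 0 < τ → τ < min t₀ t →
        w x t * Real.exp (-(2 * L * Real.sqrt t)) ≤ δ + C * Real.sqrt τ := by
      intro τ hτ hτ'
      have hτ1 := hτ'.trans_le (min_le_left _ _)
      have hτ2 := hτ'.trans_le (min_le_right _ _)
      have hlim : Tendsto (fun η : ℝ => (δ + C * Real.sqrt τ) +
          η * (Real.exp ((3 + B) * t) * (1 + x ^ 2))) (𝓝[>] 0) (𝓝 ((δ + C * Real.sqrt τ) +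
          0 * (Real.exp ((3 + B) * t) * (1 + x ^ 2)))) := by
        refine Tendsto.mono_left (Continuous.tendsto ?_ 0) nhdsWithin_le_nhds
        fun_prop
      rw [zero_mul, add_zero] at hlim
      refine ge_of_tendsto hlim ?_
      filter_upwards [self_mem_nhdsWithin] with η hη
      exact maximum_principle_barrier hx hxx ht hcont heq hb hc hN hL hτ (by positivity) hη
        (fun x => hini x τ hτ hτ1) hτ2.le h2
    have hlim : Tendsto (fun τ : ℝ => δ + C * Real.sqrt τ) (𝓝[>] 0)
        (𝓝 (δ + C * Real.sqrt 0)) := by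
      refine Tendsto.mono_left (Continuous.tendsto ?_ 0) nhdsWithin_le_nhds
      fun_prop
    rw [Real.sqrt_zero, mul_zero, add_zero] at hlim
    refine ge_of_tendsto hlim ?_
    filter_upwards [Ioo_mem_nhdsGT (lt_min ht₀ h1)] with τ hτ
    exact k1 τ hτ.1 hτ.2
  rw [Real.exp_neg, ← div_eq_mul_inv, div_le_iff₀ (Real.exp_pos _)] at key
  exact key

end maximum

/-! ### Bounds and comparison for solutions of the equation. -/

lemma h_pos (α x : ℝ) : 0 < h α x := by unfold h; positivity

lemma h_le_one {α : ℝ} (hα : 0 < α) (x : ℝ) : h α x ≤ 1 := by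
  have : 1 ≤ (1 + x ^ 2) ^ α := Real.one_le_rpow (by nlinarith [sq_nonneg x]) hα.le
  exact (div_le_one (by linarith)).2 this

lemma abs_h_le_one {α : ℝ} (hα : 0 < α) (x : ℝ) : |h α x| ≤ 1 := by
  rw [abs_of_pos (h_pos α x)]; exact h_le_one hα x

namespace IsC21

variable {u : ℝ → ℝ → ℝ}

lemma hasDerivAt_x (hu : IsC21 u) (x t : ℝ) (ht : 0 < t) :
    HasDerivAt (fun y => u y t) (dx u x t) x := (hu.diff_x x t ht).hasDerivAt

lemma hasDerivAt_xx (hu : IsC21 u) (x t : ℝ) (ht : 0 < t) :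
    HasDerivAt (fun y => dx u y t) (dx (dx u) x t) x := (hu.diff_xx x t ht).hasDerivAt

lemma hasDerivAt_t (hu : IsC21 u) (x t : ℝ) (ht : 0 < t) :
    HasDerivAt (fun s => u x s) (dt u x t) t := (hu.diff_t x t ht).hasDerivAt

end IsC21

/-- A bounded solution of `u_t = u_xx + b u_x` with bounded drift is bounded by its initial
data. -/
lemma abs_le_of_drift_equation {u b : ℝ → ℝ → ℝ} {T B N M C : ℝ} (hu : IsC21 u)
    (heq : ∀ x t, 0 < t → t ≤ T → dt u x t = dx (dx u) x t + b x t * dx u x t)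
    (hb : ∀ x t, 0 < t → t ≤ T → |b x t| ≤ B) (hN : ∀ x t, 0 < t → t ≤ T → |u x t| ≤ N)
    (hM : 0 ≤ M) (hC : 0 ≤ C) (hini : ∀ x t, 0 < t → t < 1 → |u x t| ≤ M + C * Real.sqrt t)
    {x t : ℝ} (h1 : 0 < t) (h2 : t ≤ T) : |u x t| ≤ M := by
  rw [abs_le']
  constructor
  · have := maximum_principle (w := u) (c := fun _ _ => 0) (L := 0) (fun x t => hu.hasDerivAt_x x t)
      (fun x t => hu.hasDerivAt_xx x t) (fun x t => hu.hasDerivAt_t x t) hu.cont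
      (fun x t h h' => by rw [heq x t h h']; simp) hb (fun x t _ _ => by simp)
      (fun x t h h' => (le_abs_self _).trans (hN x t h h')) le_rfl hM hC one_pos
      (fun x t h h' => (le_abs_self _).trans (hini x t h h')) (x := x) h1 h2
    simpa using this
  · have := maximum_principle (w := fun x t => -u x t) (c := fun _ _ => 0) (L := 0)
      (fun x t h => (hu.hasDerivAt_x x t h).neg)
      (fun x t h => (hu.hasDerivAt_xx x t h).neg) (fun x t h => (hu.hasDerivAt_t x t h).neg)
      hu.cont.neg
      (fun x t h h' => by rw [heq x t h h']; apply le_of_eq; ring) hb (fun x t _ _ => by simp)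
      (fun x t h h' => (neg_le_abs _).trans (hN x t h h')) le_rfl hM hC one_pos
      (fun x t h h' => (neg_le_abs _).trans (hini x t h h')) (x := x) h1 h2
    simpa using this

/-- Two solutions, one of which has a gradient of order `1/√t`, stay close if they start close. -/
lemma abs_sub_le_of_gradient_bound {α : ℝ} (hα : 0 < α) {u v : ℝ → ℝ → ℝ} {T B N L δ C t₀ : ℝ}
    (hu : IsC21 u) (hv : IsC21 v)
    (heu : ∀ x t, 0 < t → t ≤ T → dt u x t - dx (dx u) x t + h α x * u x t * dx u x t = 0)
    (hev : ∀ x t, 0 < t → t ≤ T → dt v x t - dx (dx v) x t + h α x * v x t * dx v x t = 0)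
    (hub : ∀ x t, 0 < t → t ≤ T → |u x t| ≤ B) (hvb : ∀ x t, 0 < t → t ≤ T → |v x t| ≤ N)
    (hgrad : ∀ x t, 0 < t → t ≤ T → |dx u x t| ≤ L / Real.sqrt t) (hL : 0 ≤ L)
    (hδ : 0 ≤ δ) (hC : 0 ≤ C) (ht₀ : 0 < t₀)
    (hini : ∀ x t, 0 < t → t < t₀ → |u x t - v x t| ≤ δ + C * Real.sqrt t)
    {x t : ℝ} (h1 : 0 < t) (h2 : t ≤ T) :
    |u x t - v x t| ≤ δ * Real.exp (2 * L * Real.sqrt t) := by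
  have hb : ∀ x t, 0 < t → t ≤ T → |(-(h α x * v x t))| ≤ N := by
    intro x t h h'
    rw [abs_neg, abs_mul]
    have := hvb x t h h'
    calc _ ≤ 1 * |v x t| := mul_le_mul_of_nonneg_right (abs_h_le_one hα x) (abs_nonneg _)
      _ ≤ N := by linarith
  have hc : ∀ x t, 0 < t → t ≤ T → -(h α x * dx u x t) ≤ L / Real.sqrt t := by
    intro x t h h'
    refine (neg_le_abs _).trans ?_
    rw [abs_mul]
    have := hgrad x t h h'
    calc _ ≤ 1 * |dx u x t| := mul_le_mul_of_nonneg_right (abs_h_le_one hα x) (abs_nonneg _)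
      _ ≤ _ := by linarith
  have hN : ∀ x t, 0 < t → t ≤ T → |u x t - v x t| ≤ B + N := fun x t h h' =>
    (abs_sub _ _).trans (add_le_add (hub x t h h') (hvb x t h h'))
  have hN' : ∀ x t, 0 < t → t ≤ T → |v x t - u x t| ≤ B + N := fun x t h h' => by
    rw [abs_sub_comm]; exact hN x t h h'
  have hini' : ∀ x t, 0 < t → t < t₀ → |v x t - u x t| ≤ δ + C * Real.sqrt t :=
    fun x t h h' => by rw [abs_sub_comm]; exact hini x t h h'
  rw [abs_le', neg_sub]
  constructor
  · exact maximum_principle (w := fun x t => u x t - v x t)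
      (fun x t h => (hu.hasDerivAt_x x t h).sub (hv.hasDerivAt_x x t h))
      (fun x t h => (hu.hasDerivAt_xx x t h).sub (hv.hasDerivAt_xx x t h))
      (fun x t h => (hu.hasDerivAt_t x t h).sub (hv.hasDerivAt_t x t h)) (hu.cont.sub hv.cont)
      -- From `u u_x - v v_x = v (u - v)_x + u_x (u - v)`: the drift involves `v` alone and the
      -- zeroth-order coefficient only the gradient of `u`.
      (b := fun x t => -(h α x * v x t)) (c := fun x t => -(h α x * dx u x t))
      (fun x t h h' => by linear_combination heu x t h h' - hev x t h h')
      hb hc (fun x t h h' => (le_abs_self _).trans (hN x t h h')) hL hδ hC ht₀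
      (fun x t h h' => (le_abs_self _).trans (hini x t h h')) h1 h2
  · exact maximum_principle (w := fun x t => v x t - u x t)
      (fun x t h => (hv.hasDerivAt_x x t h).sub (hu.hasDerivAt_x x t h))
      (fun x t h => (hv.hasDerivAt_xx x t h).sub (hu.hasDerivAt_xx x t h))
      (fun x t h => (hv.hasDerivAt_t x t h).sub (hu.hasDerivAt_t x t h)) (hv.cont.sub hu.cont)
      (b := fun x t => -(h α x * v x t)) (c := fun x t => -(h α x * dx u x t))
      (fun x t h h' => by linear_combination hev x t h h' - heu x t h h')
      hb hc (fun x t h h' => (le_abs_self _).trans (hN' x t h h')) hL hδ hC ht₀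
      (fun x t h h' => (le_abs_self _).trans (hini' x t h h')) h1 h2

/-! ### Interpolation and smoothing of the heat flow. -/

/-- The interpolation device behind every 1/2-Hölder estimate: a sup bound and a Lipschitz bound are
combined by their geometric mean. -/
lemma abs_le_sqrt_mul {a P Q : ℝ} (h1 : |a| ≤ P) (h2 : |a| ≤ Q) : |a| ≤ Real.sqrt (P * Q) := by
  refine Real.abs_le_sqrt ?_
  rw [← sq_abs, sq]
  exact mul_le_mul h1 h2 (abs_nonneg _) ((abs_nonneg _).trans h1)

section smoothing

variable {k k' : ℝ → ℝ} {C C' : ℝ} {g : ℝ → ℝ} {A : ℝ}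

lemma abs_smooth_sub_le (h : GaussBound k C) (h' : GaussBound k' C')
    (hk : ∀ z, HasDerivAt k (k' z) z) (hm : Measurable g) (hg : ∀ x, |g x| ≤ A) {t : ℝ}
    (ht : 0 < t) (x y : ℝ) :
    |smooth k t g x - smooth k t g y| ≤ (Real.sqrt t)⁻¹ * ((∫ z, |k' z|) * A) * |x - y| := by
  have := convex_univ.norm_image_sub_le_of_norm_hasDerivWithin_le (s := univ) (x := y) (y := x)
    (f := fun x => smooth k t g x) (f' := fun x => (Real.sqrt t)⁻¹ * smooth k' t g x)
    (C := (Real.sqrt t)⁻¹ * ((∫ z, |k' z|) * A))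
    (fun x _ => (hasDerivAt_smooth_x h h' hk hm hg ht x).hasDerivWithinAt)
    (fun x _ => by
      rw [Real.norm_eq_abs, abs_mul, abs_of_nonneg (inv_nonneg.2 (Real.sqrt_nonneg t))]
      exact mul_le_mul_of_nonneg_left (abs_smooth_le h' hg t x)
        (inv_nonneg.2 (Real.sqrt_nonneg t))) (mem_univ _) (mem_univ _)
  simpa [Real.norm_eq_abs] using this

lemma abs_smooth_sub_le_sqrt (h : GaussBound k C) (h' : GaussBound k' C')
    (hk : ∀ z, HasDerivAt k (k' z) z) (hm : Measurable g) (hg : ∀ x, |g x| ≤ A) {t : ℝ}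
    (ht : 0 < t) (x y : ℝ) :
    |smooth k t g x - smooth k t g y| ≤
      Real.sqrt (2 * (∫ z, |k z|) * ∫ z, |k' z|) * A * t ^ (-(1 / 4) : ℝ) *
        Real.sqrt |x - y| := by
  have hA : 0 ≤ A := (abs_nonneg _).trans (hg 0)
  have h1 : |smooth k t g x - smooth k t g y| ≤ 2 * ((∫ z, |k z|) * A) := by
    refine (abs_sub _ _).trans ?_
    linarith [abs_smooth_le h hg t x, abs_smooth_le h hg t y]
  have h2 := abs_le_sqrt_mul h1 (abs_smooth_sub_le h h' hk hm hg ht x y)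
  refine h2.trans (le_of_eq ?_)
  have i1 : 0 ≤ ∫ z, |k z| := integral_nonneg fun _ => abs_nonneg _
  have i2 : 0 ≤ ∫ z, |k' z| := integral_nonneg fun _ => abs_nonneg _
  have e : t ^ (-(1 / 4) : ℝ) = Real.sqrt ((Real.sqrt t)⁻¹) := by
    rw [Real.sqrt_eq_rpow, Real.sqrt_eq_rpow, ← Real.rpow_neg ht.le, ← Real.rpow_mul ht.le]
    norm_num
  have e2 : 2 * ((∫ z, |k z|) * A) * ((Real.sqrt t)⁻¹ * ((∫ z, |k' z|) * A) * |x - y|) =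
      (2 * (∫ z, |k z|) * ∫ z, |k' z|) * A ^ 2 * (Real.sqrt t)⁻¹ * |x - y| := by ring
  rw [e, e2, Real.sqrt_mul (by positivity), Real.sqrt_mul (by positivity),
    Real.sqrt_mul (by positivity), Real.sqrt_sq hA]

end smoothing

/-- Positivity and unit mass of the heat kernel give the constant 1, so the initial bound `M` enters
the maximum principle without loss. -/
lemma abs_smooth_gauss0_le {g : ℝ → ℝ} {A : ℝ} (hg : ∀ x, |g x| ≤ A) (t x : ℝ) :
    |smooth gauss0 t g x| ≤ A := by
  have := abs_smooth_le gaussBound0 hg t x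
  have e : ∀ z, |gauss0 z| = gauss0 z := fun z => abs_of_nonneg (by unfold gauss0; positivity)
  simp_rw [e] at this
  rwa [integral_gauss0, one_mul] at this

/-! ### Duhamel estimates with an exponential weight in time. -/

/-- The constant in the exponentially weighted Beta integrals. -/
def expBetaConst : ℝ := betaInt (1 / 2) (1 / 2) + Real.sqrt Real.pi

lemma expBetaConst_nonneg : 0 ≤ expBetaConst := add_nonneg (betaInt_nonneg _ _) (Real.sqrt_nonneg _)

lemma exp_neg_le_rpow {y : ℝ} (hy : 0 < y) : Real.exp (-y) ≤ y ^ (-(1 / 2) : ℝ) := by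
  rw [Real.rpow_neg hy.le, Real.exp_neg, ← Real.sqrt_eq_rpow]
  refine inv_anti₀ (Real.sqrt_pos.2 hy) ?_
  rw [Real.sqrt_le_left (Real.exp_pos _).le]
  nlinarith [Real.add_one_le_exp y, Real.exp_pos y]

/-- The decay of the weight is traded for `(μ (t - s))^(-1/2)`. The factor `μ^(-1/2)` is the
smallness used by the contraction and the Gronwall argument, and the remaining Beta integral does
not depend on `t`. -/
lemma exp_mul_le_beta {μ t s : ℝ} (hμ : 0 < μ) (hs : 0 < s) (hst : s < t) :
    s ^ (-(1 / 2) : ℝ) * Real.exp (-(μ * (t - s))) ≤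
      (Real.sqrt μ)⁻¹ * ((t - s) ^ (-(1 / 2) : ℝ) * s ^ (-(1 / 2) : ℝ)) := by
  have hts : 0 < t - s := by linarith
  have h1 := exp_neg_le_rpow (mul_pos hμ hts)
  rw [Real.mul_rpow hμ.le hts.le, Real.rpow_neg hμ.le, ← Real.sqrt_eq_rpow] at h1
  have h2 : 0 ≤ s ^ (-(1 / 2) : ℝ) := Real.rpow_nonneg hs.le _
  nlinarith [mul_le_mul_of_nonneg_left h1 h2]

lemma intervalIntegrable_rpow_mul_exp {t : ℝ} (μ : ℝ) :
    IntervalIntegrable (fun s => s ^ (-(1 / 2) : ℝ) * Real.exp (-(μ * (t - s)))) volume 0 t :=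
  (intervalIntegral.intervalIntegrable_rpow' (by norm_num)).mul_continuousOn (by fun_prop)

lemma integral_rpow_mul_exp_le {μ t : ℝ} (hμ : 0 < μ) (ht : 0 < t) :
    ∫ s in (0:ℝ)..t, s ^ (-(1 / 2) : ℝ) * Real.exp (-(μ * (t - s))) ≤
      (Real.sqrt μ)⁻¹ * betaInt (1 / 2) (1 / 2) := by
  refine (le_abs_self _).trans ((abs_integral_le_beta (a := 1 / 2) (b := 1 / 2)
    (C := (Real.sqrt μ)⁻¹)
    (by norm_num) (by norm_num) ht fun s h1 h2 => ?_).trans (le_of_eq ?_))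
  · have : 0 ≤ s ^ (-(1 / 2) : ℝ) * Real.exp (-(μ * (t - s))) :=
      mul_nonneg (Real.rpow_nonneg h1.le _) (Real.exp_pos _).le
    rw [abs_of_nonneg this]
    exact exp_mul_le_beta hμ h1 h2
  · norm_num

lemma intervalIntegrable_sub_rpow_mul_exp {t : ℝ} (μ : ℝ) :
    IntervalIntegrable (fun s => (t - s) ^ (-(1 / 2) : ℝ) * Real.exp (-(μ * (t - s))))
      volume 0 t := by
  have h0 : IntervalIntegrable (fun s => s ^ (-(1 / 2) : ℝ) * Real.exp (-(μ * s))) volume 0 t :=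
    (intervalIntegral.intervalIntegrable_rpow' (by norm_num)).mul_continuousOn (by fun_prop)
  have := (h0.comp_sub_left t).symm
  simpa using this

/-- After reflecting `s`, the integral is part of the Gamma integral `Γ(1/2) μ^(-1/2)` over `(0,
∞)`. -/
lemma integral_sub_rpow_mul_exp_le {μ t : ℝ} (hμ : 0 < μ) (ht : 0 < t) :
    ∫ s in (0:ℝ)..t, (t - s) ^ (-(1 / 2) : ℝ) * Real.exp (-(μ * (t - s))) ≤
      (Real.sqrt μ)⁻¹ * Real.sqrt Real.pi := by
  rw [intervalIntegral.integral_comp_sub_left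
    (fun s => s ^ (-(1 / 2) : ℝ) * Real.exp (-(μ * s))) t, sub_self, sub_zero,
    intervalIntegral.integral_of_le ht.le]
  have h1 := Real.integral_rpow_mul_exp_neg_mul_Ioi (a := 1 / 2) (r := μ) (by norm_num) hμ
  have hi : IntegrableOn (fun s : ℝ => s ^ (-(1 / 2) : ℝ) * Real.exp (-(μ * s))) (Ioi 0) := by
    have := integrableOn_rpow_mul_exp_neg_mul_rpow (s := -(1 / 2)) (p := 1) (b := μ)
      (by norm_num) one_pos hμ
    refine this.congr_fun (fun s _ => ?_) measurableSet_Ioi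
    simp
  rw [Real.Gamma_one_half_eq, ← Real.sqrt_eq_rpow, one_div μ, Real.sqrt_inv] at h1
  rw [← h1, show (1 / 2 - 1 : ℝ) = -(1 / 2) by norm_num]
  refine setIntegral_mono_set hi ?_ (LE.le.eventuallyLE Ioc_subset_Ioi_self)
  filter_upwards [ae_restrict_mem measurableSet_Ioi] with s hs
  exact mul_nonneg (Real.rpow_nonneg (le_of_lt hs) _) (Real.exp_pos _).le

/-- By `√t ≤ √(t - s) + √s`, the weight `√t` of the gradient norm cancels one of the two
singularities in each summand, leaving weighted integrals that are bounded uniformly in `t`. -/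
lemma sqrt_mul_beta_le {t s : ℝ} (hs : 0 < s) (hst : s < t) :
    Real.sqrt t * ((t - s) ^ (-(1 / 2) : ℝ) * s ^ (-(1 / 2) : ℝ)) ≤
      s ^ (-(1 / 2) : ℝ) + (t - s) ^ (-(1 / 2) : ℝ) := by
  have hts : 0 < t - s := by linarith
  rw [Real.rpow_neg hs.le, Real.rpow_neg hts.le, ← Real.sqrt_eq_rpow, ← Real.sqrt_eq_rpow]
  have h1 : 0 < Real.sqrt s := Real.sqrt_pos.2 hs
  have h2 : 0 < Real.sqrt (t - s) := Real.sqrt_pos.2 hts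
  have h3 : Real.sqrt t ≤ Real.sqrt (t - s) + Real.sqrt s := by
    rw [Real.sqrt_le_left (by positivity)]
    nlinarith [Real.sq_sqrt hs.le, Real.sq_sqrt hts.le, mul_pos h1 h2]
  have e : (Real.sqrt s)⁻¹ + (Real.sqrt (t - s))⁻¹ =
      (Real.sqrt (t - s) + Real.sqrt s) * ((Real.sqrt (t - s))⁻¹ * (Real.sqrt s)⁻¹) := by
    field_simp
  rw [e]
  exact mul_le_mul_of_nonneg_right h3 (by positivity)

namespace IsSource

variable {f f₁ f₂ : ℝ → ℝ → ℝ} {A A₁ A₂ d μ x t : ℝ}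

lemma abs_duhamelKernel_le_exp {k : ℝ → ℝ} {C : ℝ} (hk : GaussBound k C) (a : ℝ)
    {s : ℝ} (hst : s < t) (h : ∀ y, |f y s| ≤ d * s ^ (-(1 / 2) : ℝ) * Real.exp (μ * s)) :
    |duhamelKernel k a f x t s| ≤ (∫ z, |k z|) * d * Real.exp (μ * t) *
      ((t - s) ^ (-a) * (s ^ (-(1 / 2) : ℝ) * Real.exp (-(μ * (t - s))))) := by
  have h0 : 0 ≤ (t - s) ^ (-a) := Real.rpow_nonneg (by linarith) _
  rw [duhamelKernel, abs_mul, abs_of_nonneg h0]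
  have h1 := mul_le_mul_of_nonneg_left (abs_smooth_le hk h (t - s) x) h0
  have e : Real.exp (μ * s) = Real.exp (μ * t) * Real.exp (-(μ * (t - s))) := by
    rw [← Real.exp_add]; congr 1; ring
  rw [e] at h1
  refine h1.trans (le_of_eq ?_)
  ring

lemma abs_duhamel_gauss0_le_exp (hμ : 0 < μ) (hd : 0 ≤ d) (ht : 0 < t)
    (h : ∀ y s, 0 < s → s < t → |f y s| ≤ d * s ^ (-(1 / 2) : ℝ) * Real.exp (μ * s)) :
    |duhamel gauss0 0 f x t| ≤
      (∫ z, |gauss0 z|) * d * Real.exp (μ * t) * ((Real.sqrt μ)⁻¹ * expBetaConst) := by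
  have hi : 0 ≤ (∫ z, |gauss0 z|) * d * Real.exp (μ * t) :=
    mul_nonneg (mul_nonneg (integral_nonneg fun _ => abs_nonneg _) hd) (Real.exp_pos _).le
  have h1 : |duhamel gauss0 0 f x t| ≤ ∫ s in (0:ℝ)..t,
      (∫ z, |gauss0 z|) * d * Real.exp (μ * t) *
      (s ^ (-(1 / 2) : ℝ) * Real.exp (-(μ * (t - s)))) := by
    rw [← Real.norm_eq_abs]
    refine intervalIntegral.norm_integral_le_of_norm_le ht.le ?_
      ((intervalIntegrable_rpow_mul_exp μ).const_mul _)
    filter_upwards [ae_mem_Ioo_of_mem_uIoc ht.le] with s hs hs'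
    rw [uIoc_of_le ht.le] at hs
    obtain ⟨h1, h2⟩ := hs hs'
    have := abs_duhamelKernel_le_exp gaussBound0 0 (x := x) h2 (fun y => h y s h1 h2)
    rwa [neg_zero, Real.rpow_zero, one_mul] at this
  rw [intervalIntegral.integral_const_mul] at h1
  refine h1.trans (mul_le_mul_of_nonneg_left ?_ hi)
  refine (integral_rpow_mul_exp_le hμ ht).trans ?_
  refine mul_le_mul_of_nonneg_left ?_ (by positivity)
  exact le_add_of_nonneg_right (Real.sqrt_nonneg _)

lemma abs_duhamel_gauss1_le_exp (hμ : 0 < μ) (hd : 0 ≤ d) (ht : 0 < t)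
    (h : ∀ y s, 0 < s → s < t → |f y s| ≤ d * s ^ (-(1 / 2) : ℝ) * Real.exp (μ * s)) :
    Real.sqrt t * |duhamel gauss1 (1 / 2) f x t| ≤
      (∫ z, |gauss1 z|) * d * Real.exp (μ * t) * ((Real.sqrt μ)⁻¹ * expBetaConst) := by
  have hi : 0 ≤ (∫ z, |gauss1 z|) * d * Real.exp (μ * t) :=
    mul_nonneg (mul_nonneg (integral_nonneg fun _ => abs_nonneg _) hd) (Real.exp_pos _).le
  have hI := (intervalIntegrable_rpow_mul_exp (t := t) μ).add
    (intervalIntegrable_sub_rpow_mul_exp (t := t) μ)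
  have h1 : |Real.sqrt t * duhamel gauss1 (1 / 2) f x t| ≤ ∫ s in (0:ℝ)..t,
      (∫ z, |gauss1 z|) * d * Real.exp (μ * t) *
      (s ^ (-(1 / 2) : ℝ) * Real.exp (-(μ * (t - s))) +
        (t - s) ^ (-(1 / 2) : ℝ) * Real.exp (-(μ * (t - s)))) := by
    rw [← Real.norm_eq_abs, duhamel, ← intervalIntegral.integral_const_mul]
    refine intervalIntegral.norm_integral_le_of_norm_le ht.le ?_ (hI.const_mul _)
    filter_upwards [ae_mem_Ioo_of_mem_uIoc ht.le] with s hs hs'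
    rw [uIoc_of_le ht.le] at hs
    obtain ⟨h1, h2⟩ := hs hs'
    have h3 := abs_duhamelKernel_le_exp gaussBound1 (1 / 2) (x := x) h2 (fun y => h y s h1 h2)
    have h4 := sqrt_mul_beta_le h1 h2
    rw [Real.norm_eq_abs, abs_mul, abs_of_nonneg (Real.sqrt_nonneg t)]
    calc _ ≤ Real.sqrt t * ((∫ z, |gauss1 z|) * d * Real.exp (μ * t) *
          ((t - s) ^ (-(1 / 2) : ℝ) * (s ^ (-(1 / 2) : ℝ) * Real.exp (-(μ * (t - s)))))) :=
          mul_le_mul_of_nonneg_left h3 (Real.sqrt_nonneg t)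
      _ = (∫ z, |gauss1 z|) * d * Real.exp (μ * t) * ((Real.sqrt t *
          ((t - s) ^ (-(1 / 2) : ℝ) * s ^ (-(1 / 2) : ℝ))) * Real.exp (-(μ * (t - s)))) := by ring
      _ ≤ (∫ z, |gauss1 z|) * d * Real.exp (μ * t) * ((s ^ (-(1 / 2) : ℝ) +
          (t - s) ^ (-(1 / 2) : ℝ)) * Real.exp (-(μ * (t - s)))) :=
          mul_le_mul_of_nonneg_left (mul_le_mul_of_nonneg_right h4 (Real.exp_pos _).le) hi
      _ = _ := by ring
  rw [abs_mul, abs_of_nonneg (Real.sqrt_nonneg t), intervalIntegral.integral_const_mul,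
    intervalIntegral.integral_add (intervalIntegrable_rpow_mul_exp μ)
    (intervalIntegrable_sub_rpow_mul_exp μ)] at h1
  refine h1.trans (mul_le_mul_of_nonneg_left ?_ hi)
  rw [expBetaConst, mul_add]
  exact add_le_add (integral_rpow_mul_exp_le hμ ht) (integral_sub_rpow_mul_exp_le hμ ht)

lemma sub (h₁ : IsSource f₁ A₁) (h₂ : IsSource f₂ A₂) :
    IsSource (fun x s => f₁ x s - f₂ x s) (A₁ + A₂) where
  cont := h₁.cont.sub h₂.cont
  bound x s hs := by
    refine (abs_sub _ _).trans ?_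
    rw [add_mul]
    exact add_le_add (h₁.bound x s hs) (h₂.bound x s hs)

lemma duhamel_sub {k : ℝ → ℝ} {C : ℝ} (h₁ : IsSource f₁ A₁) (h₂ : IsSource f₂ A₂)
    (hk : GaussBound k C) {a : ℝ} (h0 : 0 ≤ a) (h1 : a < 1) (ht : 0 < t) :
    duhamel k a (fun x s => f₁ x s - f₂ x s) x t = duhamel k a f₁ x t - duhamel k a f₂ x t := by
  rw [duhamel, duhamel, duhamel, ← intervalIntegral.integral_sub
    ((h₁.singularKernel hk h0 h1).intervalIntegrable x ht)
    ((h₂.singularKernel hk h0 h1).intervalIntegrable x ht)]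
  refine intervalIntegral.integral_congr_ae ?_
  filter_upwards [ae_mem_Ioo_of_mem_uIoc ht.le] with s hs hs'
  have hs0 := (hs hs').1
  rw [duhamelKernel, duhamelKernel, duhamelKernel, smooth_sub hk
    (h₁.continuous_slice hs0).measurable (fun y => h₁.bound y s hs0)
    (h₂.continuous_slice hs0).measurable (fun y => h₂.bound y s hs0), mul_sub]

lemma abs_duhamel_le {k : ℝ → ℝ} {C : ℝ} (hf : IsSource f A) (hk : GaussBound k C) {a : ℝ}
    (h1 : a < 1) (ht : 0 < t) :
    |duhamel k a f x t| ≤ (∫ z, |k z|) * A * (t ^ (1 - a - 1 / 2) * betaInt a (1 / 2)) :=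
  abs_integral_le_beta h1 (by norm_num) ht fun _ hs hst => hf.abs_duhamelKernel_le hk a x hs hst

end IsSource

/-! ### The truncated problem and its fixed point. -/

/-- Truncation of a real number to `[-M, M]`. -/
def clamp (M r : ℝ) : ℝ := max (-M) (min M r)

section clamp

variable {M r s : ℝ}

lemma abs_clamp_le (hM : 0 ≤ M) (r : ℝ) : |clamp M r| ≤ M :=
  abs_le.2 ⟨le_max_left _ _, max_le (by linarith) (min_le_left _ _)⟩

lemma clamp_eq_self (h : |r| ≤ M) : clamp M r = r := by
  rw [clamp, min_eq_right (abs_le.1 h).2, max_eq_right (abs_le.1 h).1]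

lemma abs_clamp_sub_le (M r s : ℝ) : |clamp M r - clamp M s| ≤ |r - s| := by
  unfold clamp
  refine (abs_max_sub_max_le_max _ _ _ _).trans ?_
  rw [sub_self, abs_zero]
  refine max_le (abs_nonneg _) ((abs_min_sub_min_le_max _ _ _ _).trans ?_)
  rw [sub_self, abs_zero]
  exact max_le (abs_nonneg _) le_rfl

lemma abs_clamp_le_abs (hM : 0 ≤ M) (r : ℝ) : |clamp M r| ≤ |r| := by
  have := abs_clamp_sub_le M r 0
  rwa [clamp_eq_self (by simpa using hM : |(0:ℝ)| ≤ M), sub_zero, sub_zero] at this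

lemma continuous_clamp (M : ℝ) : Continuous (clamp M) := by unfold clamp; fun_prop

end clamp

lemma continuous_h (α : ℝ) : Continuous (h α) := by
  unfold h
  refine continuous_const.div (Continuous.rpow_const (by fun_prop) fun x => Or.inl ?_) fun x => ?_
  · positivity
  · positivity

/-- The truncated nonlinearity `√t h u u_x` evaluated along the mild solution with source `f`. -/
def truncated (α M K : ℝ) (g : ℝ → ℝ) (f : ℝ → ℝ → ℝ) (x t : ℝ) : ℝ :=
  h α x * clamp M (mild g f x t) * clamp K (Real.sqrt t * mildX g f x t)

section truncated

variable {α M K : ℝ} {g : ℝ → ℝ} {f f₁ f₂ : ℝ → ℝ → ℝ} {A A₁ A₂ : ℝ}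

lemma abs_truncated_le (hα : 0 < α) (hM : 0 ≤ M) (hK : 0 ≤ K) (x t : ℝ) :
    |truncated α M K g f x t| ≤ M * K := by
  rw [truncated, abs_mul, abs_mul]
  have h1 := abs_h_le_one hα x
  have h2 := abs_clamp_le hM (mild g f x t)
  have h3 := abs_clamp_le hK (Real.sqrt t * mildX g f x t)
  calc _ ≤ 1 * M * K := by gcongr
    _ = M * K := by ring

lemma continuousOn_truncated (hm : Measurable g) (hg : ∀ x, |g x| ≤ M) (hf : IsSource f A) :
    ContinuousOn (fun p : ℝ × ℝ => truncated α M K g f p.1 p.2) domain := by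
  have h1 : Continuous fun p : ℝ × ℝ => h α p.1 := (continuous_h α).comp continuous_fst
  have h2 : Continuous fun p : ℝ × ℝ => Real.sqrt p.2 := by fun_prop
  exact (h1.continuousOn.mul ((continuous_clamp M).comp_continuousOn
    (continuousOn_mild hm hg hf))).mul ((continuous_clamp K).comp_continuousOn
    (h2.continuousOn.mul (continuousOn_mildX hm hg hf)))

/-- Contraction estimate in the weighted norm. The data cancel in the difference, clamping is
1-Lipschitz, and each factor of the product is bounded by its clamp, so only the weighted Duhamel
bounds with their factor `μ^(-1/2)` remain. -/
lemma abs_truncated_sub_le (hα : 0 < α) (hM : 0 ≤ M) (hK : 0 ≤ K)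
    (h₁ : IsSource f₁ A₁) (h₂ : IsSource f₂ A₂) {d μ : ℝ} (hμ : 0 < μ) (hd : 0 ≤ d)
    (h : ∀ y s, 0 < s → |f₁ y s - f₂ y s| ≤ d * s ^ (-(1 / 2) : ℝ) * Real.exp (μ * s))
    (x : ℝ) {t : ℝ} (ht : 0 < t) :
    |truncated α M K g f₁ x t - truncated α M K g f₂ x t| ≤
      ((K * (∫ z, |gauss0 z|) + M * ∫ z, |gauss1 z|) * expBetaConst * (Real.sqrt μ)⁻¹) * d *
        Real.exp (μ * t) := by
  have e0 := h₁.duhamel_sub h₂ gaussBound0 le_rfl one_pos ht (x := x)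
  have e1 := h₁.duhamel_sub h₂ gaussBound1 (a := 1 / 2) (by norm_num) (by norm_num) ht (x := x)
  have b0 := IsSource.abs_duhamel_gauss0_le_exp (x := x) hμ hd ht fun y s hs _ => h y s hs
  have b1 := IsSource.abs_duhamel_gauss1_le_exp (x := x) hμ hd ht fun y s hs _ => h y s hs
  rw [e0] at b0
  rw [e1] at b1
  have c0 : |clamp M (mild g f₁ x t) - clamp M (mild g f₂ x t)| ≤
      |duhamel gauss0 0 f₁ x t - duhamel gauss0 0 f₂ x t| := by
    refine (abs_clamp_sub_le _ _ _).trans (le_of_eq ?_)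
    rw [abs_sub_comm (duhamel gauss0 0 f₁ x t)]
    simp only [mild]; congr 1; ring
  have c1 : |clamp K (Real.sqrt t * mildX g f₁ x t) - clamp K (Real.sqrt t * mildX g f₂ x t)| ≤
      Real.sqrt t * |duhamel gauss1 (1 / 2) f₁ x t - duhamel gauss1 (1 / 2) f₂ x t| := by
    refine (abs_clamp_sub_le _ _ _).trans (le_of_eq ?_)
    rw [abs_sub_comm (duhamel gauss1 (1 / 2) f₁ x t), ← abs_of_nonneg (Real.sqrt_nonneg t),
      ← abs_mul, abs_of_nonneg (Real.sqrt_nonneg t)]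
    simp only [mildX]; congr 1; ring
  have k1 := abs_clamp_le hK (Real.sqrt t * mildX g f₁ x t)
  have k2 := abs_clamp_le hM (mild g f₂ x t)
  have e : truncated α M K g f₁ x t - truncated α M K g f₂ x t = GenBurgers.h α x *
      ((clamp M (mild g f₁ x t) - clamp M (mild g f₂ x t)) *
        clamp K (Real.sqrt t * mildX g f₁ x t) + clamp M (mild g f₂ x t) *
        (clamp K (Real.sqrt t * mildX g f₁ x t) - clamp K (Real.sqrt t * mildX g f₂ x t))) := by
    simp only [truncated]; ring
  rw [e, abs_mul]
  refine (mul_le_mul (abs_h_le_one hα x) (abs_add_le _ _) (abs_nonneg _) zero_le_one).trans ?_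
  rw [one_mul, abs_mul, abs_mul]
  refine (add_le_add (mul_le_mul (c0.trans b0) k1 (abs_nonneg _)
    ((abs_nonneg _).trans (c0.trans b0))) (mul_le_mul k2 (c1.trans b1) (abs_nonneg _) hM)).trans
    (le_of_eq ?_)
  ring

end truncated

/-- The source term obtained from a bounded function after removal of the weight. -/
def weightedSource (μ A : ℝ) (F : ℝ × Ioi (0:ℝ) → ℝ) (x s : ℝ) : ℝ :=
  -- Clamping makes every bounded continuous `F` produce a source of size `A`, so the contraction
  -- runs on the whole Banach space rather than on a subset.
  if hs : 0 < s then s ^ (-(1 / 2) : ℝ) * clamp A (Real.exp (μ * s) * F (x, ⟨s, hs⟩)) else 0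

lemma isSource_weightedSource (μ : ℝ) {A : ℝ} (hA : 0 ≤ A) {F : ℝ × Ioi (0:ℝ) → ℝ}
    (hF : Continuous F) : IsSource (weightedSource μ A F) A where
  cont := by
    rw [continuousOn_iff_continuous_domRestrict]
    have e : domain.domRestrict (fun p : ℝ × ℝ => weightedSource μ A F p.1 p.2) = fun p =>
        p.1.2 ^ (-(1 / 2) : ℝ) * clamp A (Real.exp (μ * p.1.2) * F (p.1.1, ⟨p.1.2, mem_domain.1 p.2⟩)) := by
      ext p
      rw [domRestrict_apply, weightedSource, dif_pos (mem_domain.1 p.2)]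
    rw [e]
    refine Continuous.mul ?_ ((continuous_clamp A).comp (Continuous.mul (by fun_prop)
      (hF.comp ?_)))
    · exact Continuous.rpow_const (by fun_prop) fun p => Or.inl (show (0:ℝ) < p.1.2 from p.2.2).ne'
    · exact (by fun_prop : Continuous fun p : domain => p.1.1).prodMk
        (Continuous.subtype_mk (by fun_prop) _)
  bound x s hs := by
    have h0 := Real.rpow_nonneg hs.le (-(1 / 2))
    rw [weightedSource, dif_pos hs, abs_mul, abs_of_nonneg h0, mul_comm]
    exact mul_le_mul_of_nonneg_right (abs_clamp_le hA _) h0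

/-- Solvability of the truncated problem in mild form. -/
lemma exists_truncated_source {α M K : ℝ} (hα : 0 < α) (hK : 0 ≤ K) {g : ℝ → ℝ}
    (hm : Measurable g) (hg : ∀ x, |g x| ≤ M) :
    ∃ f, IsSource f (M * K) ∧
      ∀ x s, 0 < s → f x s = s ^ (-(1 / 2) : ℝ) * truncated α M K g f x s := by
  have hM : 0 ≤ M := (abs_nonneg _).trans (hg 0)
  have hMK : 0 ≤ M * K := mul_nonneg hM hK
  set Q : ℝ := (K * (∫ z, |gauss0 z|) + M * ∫ z, |gauss1 z|) * expBetaConst with hQ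
  have hQ0 : 0 ≤ Q := by
    have i0 : 0 ≤ ∫ z, |gauss0 z| := integral_nonneg fun _ => abs_nonneg _
    have i1 : 0 ≤ ∫ z, |gauss1 z| := integral_nonneg fun _ => abs_nonneg _
    have := expBetaConst_nonneg
    positivity
  -- Then `Q/√μ = Q/(2 Q + 1) ≤ 1/2`, which is the contraction constant.
  set μ : ℝ := (2 * Q + 1) ^ 2 with hμd
  have hμ : 0 < μ := by positivity
  have hμs : Q * (Real.sqrt μ)⁻¹ ≤ 1 / 2 := by
    rw [hμd, Real.sqrt_sq (by positivity), ← div_eq_mul_inv, div_le_iff₀ (by positivity)]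
    linarith
  let E := BoundedContinuousFunction (ℝ × Ioi (0:ℝ)) ℝ
  have hs : ∀ F : E, IsSource (weightedSource μ (M * K) F) (M * K) :=
    fun F => isSource_weightedSource μ hMK F.continuous
  have hcont : ∀ F : E, Continuous fun p : ℝ × Ioi (0:ℝ) => Real.exp (-(μ * p.2)) *
      truncated α M K g (weightedSource μ (M * K) F) p.1 p.2 := by
    intro F
    refine Continuous.mul (by fun_prop) ?_
    exact (continuousOn_truncated hm hg (hs F)).comp_continuous
      (f := fun p : ℝ × Ioi (0:ℝ) => ((p.1, (p.2 : ℝ)) : ℝ × ℝ)) (by fun_prop)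
      fun p => mem_domain.2 p.2.2
  have hbd : ∀ (F : E) (p : ℝ × Ioi (0:ℝ)), ‖Real.exp (-(μ * p.2)) *
      truncated α M K g (weightedSource μ (M * K) F) p.1 p.2‖ ≤ M * K := by
    intro F p
    have hp : (0:ℝ) < p.2 := p.2.2
    rw [Real.norm_eq_abs, abs_mul, abs_of_pos (Real.exp_pos _)]
    have h1 : Real.exp (-(μ * p.2)) ≤ 1 := Real.exp_le_one_iff.2 (by
      simp only [Left.neg_nonpos_iff]; positivity)
    have h2 := abs_truncated_le hα hM hK (g := g) (f := weightedSource μ (M * K) F) p.1 p.2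
    calc _ ≤ 1 * (M * K) := by gcongr
      _ = M * K := one_mul _
  let Φ : E → E := fun F => BoundedContinuousFunction.ofNormedAddCommGroup _ (hcont F) _ (hbd F)
  have hΦ : ∀ F p, Φ F p = Real.exp (-(μ * p.2)) *
      truncated α M K g (weightedSource μ (M * K) F) p.1 p.2 := fun F p => rfl
  have hlip : ContractingWith (1 / 2) Φ := by
    refine ⟨by norm_num, LipschitzWith.of_dist_le_mul fun F G => ?_⟩
    refine (BoundedContinuousFunction.dist_le (by positivity)).2 fun p => ?_
    have hp : (0:ℝ) < p.2 := p.2.2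
    have hd : ∀ y s, 0 < s → |weightedSource μ (M * K) F y s - weightedSource μ (M * K) G y s| ≤
        dist F G * s ^ (-(1 / 2) : ℝ) * Real.exp (μ * s) := by
      intro y s hs
      have h0 := Real.rpow_nonneg hs.le (-(1 / 2))
      rw [weightedSource, weightedSource, dif_pos hs, dif_pos hs, ← mul_sub, abs_mul,
        abs_of_nonneg h0]
      have h1 := abs_clamp_sub_le (M * K) (Real.exp (μ * s) * F (y, ⟨s, hs⟩))
        (Real.exp (μ * s) * G (y, ⟨s, hs⟩))
      rw [← mul_sub, abs_mul, abs_of_pos (Real.exp_pos _), ← Real.dist_eq] at h1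
      have h2 := BoundedContinuousFunction.dist_coe_le_dist (f := F) (g := G) (y, ⟨s, hs⟩)
      calc _ ≤ s ^ (-(1 / 2) : ℝ) * (Real.exp (μ * s) * dist F G) :=
            mul_le_mul_of_nonneg_left (h1.trans
              (mul_le_mul_of_nonneg_left h2 (Real.exp_pos _).le)) h0
        _ = _ := by ring
    have key := abs_truncated_sub_le (g := g) hα hM hK (hs F) (hs G) hμ dist_nonneg hd p.1 hp
    rw [Real.dist_eq, hΦ, hΦ, ← mul_sub, abs_mul, abs_of_pos (Real.exp_pos _), Real.exp_neg,
      inv_mul_le_iff₀ (Real.exp_pos _)]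
    refine key.trans ?_
    rw [mul_comm (Real.exp _)]
    refine mul_le_mul_of_nonneg_right (mul_le_mul_of_nonneg_right ?_ dist_nonneg)
      (Real.exp_pos _).le
    simpa using hμs
  obtain ⟨F, hF⟩ : ∃ F : E, Φ F = F := ⟨_, hlip.fixedPoint_isFixedPt⟩
  refine ⟨weightedSource μ (M * K) F, hs F, fun x s hs => ?_⟩
  have h1 := hΦ F (x, ⟨s, hs⟩)
  rw [hF] at h1
  have h2 : Real.exp (μ * s) * F (x, ⟨s, hs⟩) =
      truncated α M K g (weightedSource μ (M * K) F) x s := by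
    rw [h1, ← mul_assoc, ← Real.exp_add, add_neg_cancel, Real.exp_zero, one_mul]
  -- At the fixed point the clamped quantity is the truncated nonlinearity, already bounded by `M *
  -- K`, so the clamp in `weightedSource` is inactive.
  conv_lhs => rw [weightedSource, dif_pos hs, h2,
    clamp_eq_self (abs_truncated_le hα hM hK x s)]

/-! ### Hölder continuity in space of the source. -/

lemma hasDerivAt_h (α x : ℝ) :
    HasDerivAt (h α) (-(2 * α * x) * (1 + x ^ 2) ^ (-α - 1)) x := by
  have h0 : 0 < 1 + x ^ 2 := by positivity
  have e : h α = fun x => (1 + x ^ 2) ^ (-α) := by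
    ext y
    rw [h, Real.rpow_neg (by positivity), one_div]
  rw [e]
  have := ((hasDerivAt_pow 2 x).const_add 1).rpow_const (p := -α) (Or.inl h0.ne')
  refine this.congr_deriv ?_
  simp only [Nat.cast_ofNat, Nat.add_one_sub_one, pow_one]
  ring

/-- Interpolation between oscillation at most 1 and Lipschitz constant `α`; the latter comes from `2
|x| ≤ 1 + x²` in the formula for the derivative. -/
lemma abs_h_sub_le {α : ℝ} (hα : 0 < α) (x y : ℝ) :
    |h α x - h α y| ≤ Real.sqrt α * Real.sqrt |x - y| := by
  have h1 : |h α x - h α y| ≤ 1 := by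
    rw [abs_le]
    have := h_pos α x
    have := h_pos α y
    have := h_le_one hα x
    have := h_le_one hα y
    constructor <;> linarith
  have h2 : |h α x - h α y| ≤ α * |x - y| := by
    have := convex_univ.norm_image_sub_le_of_norm_hasDerivWithin_le (s := univ) (x := y) (y := x)
      (f := h α) (f' := fun x => -(2 * α * x) * (1 + x ^ 2) ^ (-α - 1)) (C := α)
      (fun x _ => (hasDerivAt_h α x).hasDerivWithinAt)
      (fun x _ => by
        have h0 : 1 ≤ 1 + x ^ 2 := by nlinarith [sq_nonneg x]
        have h3 : (1 + x ^ 2) ^ (-α - 1) ≤ (1 + x ^ 2)⁻¹ := by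
          rw [← Real.rpow_neg_one]
          exact Real.rpow_le_rpow_of_exponent_le h0 (by linarith)
        have h4 : |2 * α * x| ≤ α * (1 + x ^ 2) := by
          rw [abs_mul, abs_of_pos (by positivity : 0 < 2 * α)]
          nlinarith [sq_abs x, mul_nonneg hα.le (sq_nonneg (|x| - 1))]
        rw [Real.norm_eq_abs, abs_mul, abs_neg, abs_of_nonneg (Real.rpow_nonneg (by linarith) _)]
        calc _ ≤ (α * (1 + x ^ 2)) * (1 + x ^ 2)⁻¹ := by gcongr
          _ = α := by field_simp) (mem_univ _) (mem_univ _)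
    simpa [Real.norm_eq_abs] using this
  have := abs_le_sqrt_mul h1 h2
  rwa [one_mul, Real.sqrt_mul hα.le] at this

section regularity

variable {g : ℝ → ℝ} {M : ℝ} {f : ℝ → ℝ → ℝ} {A : ℝ}

lemma sqrt_mul_abs_mildX_le (hg : ∀ x, |g x| ≤ M) (x : ℝ) {t : ℝ} (ht : 0 < t) :
    Real.sqrt t * |mildX g f x t| ≤
      (∫ z, |gauss1 z|) * M + Real.sqrt t * |duhamel gauss1 (1 / 2) f x t| := by
  have hs : 0 < Real.sqrt t := Real.sqrt_pos.2 ht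
  have h1 := abs_smooth_le gaussBound1 hg t x
  have h2 : |mildX g f x t| ≤ (Real.sqrt t)⁻¹ * |smooth gauss1 t g x| +
      |duhamel gauss1 (1 / 2) f x t| := by
    refine (abs_sub _ _).trans ?_
    rw [abs_mul, abs_of_pos (inv_pos.2 hs)]
  calc _ ≤ Real.sqrt t * ((Real.sqrt t)⁻¹ * |smooth gauss1 t g x| +
        |duhamel gauss1 (1 / 2) f x t|) := mul_le_mul_of_nonneg_left h2 hs.le
    _ = |smooth gauss1 t g x| + Real.sqrt t * |duhamel gauss1 (1 / 2) f x t| := by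
        field_simp
    _ ≤ _ := by linarith

lemma abs_mildX_le (hg : ∀ x, |g x| ≤ M) (hf : IsSource f A) (x : ℝ) {t : ℝ} (ht : 0 < t) :
    Real.sqrt t * |mildX g f x t| ≤ (∫ z, |gauss1 z|) * M +
      Real.sqrt t * ((∫ z, |gauss1 z|) * A * betaInt (1 / 2) (1 / 2)) := by
  refine (sqrt_mul_abs_mildX_le hg x ht).trans (add_le_add le_rfl
    (mul_le_mul_of_nonneg_left ?_ (Real.sqrt_nonneg t)))
  have := hf.abs_duhamel_le gaussBound1 (a := 1 / 2) (x := x) (by norm_num) ht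
  norm_num at this ⊢
  exact this

lemma abs_mild_sub_smooth_le (hf : IsSource f A) (x : ℝ) {t : ℝ} (ht : 0 < t) :
    |mild g f x t - smooth gauss0 t g x| ≤
      (∫ z, |gauss0 z|) * A * betaInt 0 (1 / 2) * Real.sqrt t := by
  have := hf.abs_duhamel_le gaussBound0 (a := 0) (x := x) (by norm_num) ht
  rw [mild, sub_sub_cancel_left, abs_neg, Real.sqrt_eq_rpow]
  refine this.trans (le_of_eq ?_)
  norm_num
  ring

/-- The space derivative of a mild solution is Hölder continuous of exponent `1/2`. -/
lemma exists_holder_mildX (hm : Measurable g) (hg : ∀ x, |g x| ≤ M) (hf : IsSource f A) (T : ℝ)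
    (hT : 0 < T) : ∃ H, 0 ≤ H ∧ ∀ x y t, 0 < t → t ≤ T →
      |mildX g f x t - mildX g f y t| ≤ H * t ^ (-(3 / 4) : ℝ) * Real.sqrt |x - y| := by
  have hM : 0 ≤ M := (abs_nonneg _).trans (hg 0)
  have hA := hf.nonneg
  set S : ℝ := Real.sqrt (2 * (∫ z, |gauss1 z|) * ∫ z, |gauss2 z|) with hS
  have hS0 : 0 ≤ S := Real.sqrt_nonneg _
  have hB := betaInt_nonneg (3 / 4) (1 / 2)
  refine ⟨S * M + S * A * (betaInt (3 / 4) (1 / 2) * Real.sqrt T), by positivity,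
    fun x y t ht htT => ?_⟩
  have hr : 0 ≤ Real.sqrt |x - y| := Real.sqrt_nonneg _
  have e1 : mildX g f x t - mildX g f y t =
      (Real.sqrt t)⁻¹ * (smooth gauss1 t g x - smooth gauss1 t g y) -
      (duhamel gauss1 (1 / 2) f x t - duhamel gauss1 (1 / 2) f y t) := by
    simp only [mildX]; ring
  have b1 : |(Real.sqrt t)⁻¹ * (smooth gauss1 t g x - smooth gauss1 t g y)| ≤
      S * M * t ^ (-(3 / 4) : ℝ) * Real.sqrt |x - y| := by
    rw [abs_mul, abs_of_nonneg (inv_nonneg.2 (Real.sqrt_nonneg t))]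
    have := abs_smooth_sub_le_sqrt gaussBound1 gaussBound2 hasDerivAt_gauss1 hm hg ht x y
    have e : t ^ (-(3 / 4) : ℝ) = (Real.sqrt t)⁻¹ * t ^ (-(1 / 4) : ℝ) := by
      rw [Real.sqrt_eq_rpow, ← Real.rpow_neg ht.le, ← Real.rpow_add ht]; norm_num
    calc _ ≤ (Real.sqrt t)⁻¹ * (S * M * t ^ (-(1 / 4) : ℝ) * Real.sqrt |x - y|) :=
          mul_le_mul_of_nonneg_left this (inv_nonneg.2 (Real.sqrt_nonneg t))
      _ = _ := by rw [e]; ring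
  have b2 : |duhamel gauss1 (1 / 2) f x t - duhamel gauss1 (1 / 2) f y t| ≤
      S * A * (betaInt (3 / 4) (1 / 2) * Real.sqrt T) * t ^ (-(3 / 4) : ℝ) *
        Real.sqrt |x - y| := by
    have hK := hf.singularKernel gaussBound1 (a := 1 / 2) (by norm_num) (by norm_num)
    rw [duhamel, duhamel, ← intervalIntegral.integral_sub (hK.intervalIntegrable x ht)
      (hK.intervalIntegrable y ht)]
    have := abs_integral_le_beta (a := 3 / 4) (b := 1 / 2) (C := S * A * Real.sqrt |x - y|)
      (F := fun s => duhamelKernel gauss1 (1 / 2) f x t s - duhamelKernel gauss1 (1 / 2) f y t s)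
      (by norm_num) (by norm_num) ht (fun s hs hst => by
        have hts : 0 < t - s := by linarith
        have h0 := Real.rpow_nonneg hts.le (-(1 / 2))
        rw [duhamelKernel, duhamelKernel, ← mul_sub, abs_mul, abs_of_nonneg h0]
        have := abs_smooth_sub_le_sqrt gaussBound1 gaussBound2 hasDerivAt_gauss1
          (hf.continuous_slice hs).measurable (fun y => hf.bound y s hs) hts x y
        have e : (t - s) ^ (-(3 / 4) : ℝ) =
            (t - s) ^ (-(1 / 2) : ℝ) * (t - s) ^ (-(1 / 4) : ℝ) := by
          rw [← Real.rpow_add hts]; norm_num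
        calc _ ≤ (t - s) ^ (-(1 / 2) : ℝ) * (S * (A * s ^ (-(1 / 2) : ℝ)) *
              (t - s) ^ (-(1 / 4) : ℝ) * Real.sqrt |x - y|) := mul_le_mul_of_nonneg_left this h0
          _ = _ := by rw [e]; ring)
    refine this.trans ?_
    -- The Duhamel part is only of order `t^(-1/4)`. The factor `√t ≤ √T` is given away to match the
    -- `t^(-3/4)` of the heat flow part.
    have e : t ^ (1 - 3 / 4 - 1 / 2 : ℝ) = Real.sqrt t * t ^ (-(3 / 4) : ℝ) := by
      rw [Real.sqrt_eq_rpow, ← Real.rpow_add ht]; norm_num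
    have h1 : Real.sqrt t ≤ Real.sqrt T := Real.sqrt_le_sqrt htT
    have h2 : 0 ≤ t ^ (-(3 / 4) : ℝ) := Real.rpow_nonneg ht.le _
    rw [e]
    calc _ = S * A * (betaInt (3 / 4) (1 / 2) * Real.sqrt t) * t ^ (-(3 / 4) : ℝ) *
          Real.sqrt |x - y| := by ring
      _ ≤ _ := by gcongr
  rw [e1, add_mul, add_mul]
  exact (abs_sub _ _).trans (add_le_add b1 b2)

/-- The clamp supplies the sup bound `2 M` and `abs_mildX_le` the Lipschitz bound `P/√t`; their
geometric mean is of order `t^(-1/4)`. -/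
lemma exists_holder_clamp_mild (hm : Measurable g) (hg : ∀ x, |g x| ≤ M) (hf : IsSource f A)
    (T : ℝ) : ∃ H, 0 ≤ H ∧ ∀ x y t, 0 < t → t ≤ T →
      |clamp M (mild g f x t) - clamp M (mild g f y t)| ≤
        H * t ^ (-(1 / 4) : ℝ) * Real.sqrt |x - y| := by
  have hM : 0 ≤ M := (abs_nonneg _).trans (hg 0)
  have hA := hf.nonneg
  have hB := betaInt_nonneg (1 / 2) (1 / 2)
  have i1 : 0 ≤ ∫ z, |gauss1 z| := integral_nonneg fun _ => abs_nonneg _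
  set P : ℝ := (∫ z, |gauss1 z|) * M +
    Real.sqrt T * ((∫ z, |gauss1 z|) * A * betaInt (1 / 2) (1 / 2)) with hP
  have hP0 : 0 ≤ P := by positivity
  refine ⟨Real.sqrt (2 * M * P), Real.sqrt_nonneg _, fun x y t ht htT => ?_⟩
  have hs : 0 < Real.sqrt t := Real.sqrt_pos.2 ht
  have h1 : |clamp M (mild g f x t) - clamp M (mild g f y t)| ≤ 2 * M := by
    refine (abs_sub _ _).trans ?_
    linarith [abs_clamp_le hM (mild g f x t), abs_clamp_le hM (mild g f y t)]
  have h2 : |clamp M (mild g f x t) - clamp M (mild g f y t)| ≤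
      P * (Real.sqrt t)⁻¹ * |x - y| := by
    refine (abs_clamp_sub_le _ _ _).trans ?_
    have := convex_univ.norm_image_sub_le_of_norm_hasDerivWithin_le (s := univ) (x := y) (y := x)
      (f := fun x => mild g f x t) (f' := fun x => mildX g f x t) (C := P * (Real.sqrt t)⁻¹)
      (fun x _ => (hasDerivAt_mild hm hg hf x ht).hasDerivWithinAt)
      (fun x _ => by
        rw [Real.norm_eq_abs, ← div_eq_mul_inv, le_div_iff₀ hs, mul_comm]
        refine (abs_mildX_le hg hf x ht).trans ?_
        have : Real.sqrt t ≤ Real.sqrt T := Real.sqrt_le_sqrt htT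
        rw [hP]
        gcongr) (mem_univ _) (mem_univ _)
    simpa [Real.norm_eq_abs] using this
  refine (abs_le_sqrt_mul h1 h2).trans (le_of_eq ?_)
  have e : t ^ (-(1 / 4) : ℝ) = Real.sqrt ((Real.sqrt t)⁻¹) := by
    rw [Real.sqrt_eq_rpow, Real.sqrt_eq_rpow, ← Real.rpow_neg ht.le, ← Real.rpow_mul ht.le]
    norm_num
  rw [e, show 2 * M * (P * (Real.sqrt t)⁻¹ * |x - y|) =
    2 * M * P * (Real.sqrt t)⁻¹ * |x - y| by ring, Real.sqrt_mul (by positivity),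
    Real.sqrt_mul (by positivity)]

/-- The product is varied one factor at a time. The two clamps vary by order `s^(-1/4)`, the second
because `√s s^(-3/4) = s^(-1/4)`; with the prefactor `s^(-1/2)` this is the exponent `-3/4` of
`IsHolderSource`. -/
lemma isHolderSource_truncated {α K : ℝ} (hα : 0 < α) (hK : 0 ≤ K) (hm : Measurable g)
    (hg : ∀ x, |g x| ≤ M) (hf : IsSource f A)
    (hfix : ∀ x s, 0 < s → f x s = s ^ (-(1 / 2) : ℝ) * truncated α M K g f x s) :
    IsHolderSource f := by
  intro T hT
  have hM : 0 ≤ M := (abs_nonneg _).trans (hg 0)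
  obtain ⟨H1, hH1, h1⟩ := exists_holder_mildX hm hg hf T hT
  obtain ⟨H2, hH2, h2⟩ := exists_holder_clamp_mild hm hg hf T
  refine ⟨Real.sqrt α * (M * K) * T ^ (1 / 4 : ℝ) + H2 * K + M * H1, by positivity,
    fun x y s hs hsT => ?_⟩
  have hs0 := Real.rpow_nonneg hs.le (-(1 / 2))
  have hsq : 0 < Real.sqrt s := Real.sqrt_pos.2 hs
  set r := Real.sqrt |x - y| with hr
  have hr0 : 0 ≤ r := Real.sqrt_nonneg _
  have a1 := abs_h_sub_le hα x y
  have a2 := h2 x y s hs hsT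
  have a3 : |clamp K (Real.sqrt s * mildX g f x s) - clamp K (Real.sqrt s * mildX g f y s)| ≤
      Real.sqrt s * (H1 * s ^ (-(3 / 4) : ℝ) * r) := by
    refine (abs_clamp_sub_le _ _ _).trans ?_
    rw [← mul_sub, abs_mul, abs_of_pos hsq]
    exact mul_le_mul_of_nonneg_left (h1 x y s hs hsT) hsq.le
  have c1 := abs_clamp_le hM (mild g f x s)
  have c2 := abs_clamp_le hM (mild g f y s)
  have c3 := abs_clamp_le hK (Real.sqrt s * mildX g f x s)
  have c4 := abs_h_le_one hα y
  have e : truncated α M K g f x s - truncated α M K g f y s =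
      (h α x - h α y) * (clamp M (mild g f x s) * clamp K (Real.sqrt s * mildX g f x s)) +
      h α y * ((clamp M (mild g f x s) - clamp M (mild g f y s)) *
        clamp K (Real.sqrt s * mildX g f x s)) +
      h α y * (clamp M (mild g f y s) *
        (clamp K (Real.sqrt s * mildX g f x s) - clamp K (Real.sqrt s * mildX g f y s))) := by
    simp only [truncated]; ring
  have b : |truncated α M K g f x s - truncated α M K g f y s| ≤
      (Real.sqrt α * r) * (M * K) + 1 * ((H2 * s ^ (-(1 / 4) : ℝ) * r) * K) +
        1 * (M * (Real.sqrt s * (H1 * s ^ (-(3 / 4) : ℝ) * r))) := by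
    rw [e]
    refine (abs_add_le _ _).trans (add_le_add ((abs_add_le _ _).trans (add_le_add ?_ ?_)) ?_)
    · rw [abs_mul, abs_mul]
      gcongr
    · rw [abs_mul, abs_mul]
      gcongr
    · rw [abs_mul, abs_mul]
      gcongr
  rw [hfix x s hs, hfix y s hs, ← mul_sub, abs_mul, abs_of_nonneg hs0]
  have e1 : Real.sqrt s * s ^ (-(3 / 4) : ℝ) = s ^ (-(1 / 4) : ℝ) := by
    rw [Real.sqrt_eq_rpow, ← Real.rpow_add hs]; norm_num
  have e2 : s ^ (-(3 / 4) : ℝ) = s ^ (-(1 / 2) : ℝ) * s ^ (-(1 / 4) : ℝ) := by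
    rw [← Real.rpow_add hs]; norm_num
  -- The variation of `h` carries no singular factor; it is brought to the common order `s^(-1/4)`
  -- at the price of `T^(1/4)`.
  have e3 : (1:ℝ) ≤ T ^ (1 / 4 : ℝ) * s ^ (-(1 / 4) : ℝ) := by
    rw [Real.rpow_neg hs.le, ← div_eq_mul_inv, le_div_iff₀ (Real.rpow_pos_of_pos hs _), one_mul]
    exact Real.rpow_le_rpow hs.le hsT (by norm_num)
  have hq : 0 ≤ Real.sqrt α * r * (M * K) := by positivity
  calc _ ≤ s ^ (-(1 / 2) : ℝ) * ((Real.sqrt α * r) * (M * K) +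
        1 * ((H2 * s ^ (-(1 / 4) : ℝ) * r) * K) +
        1 * (M * (Real.sqrt s * (H1 * s ^ (-(3 / 4) : ℝ) * r)))) :=
        mul_le_mul_of_nonneg_left b hs0
    _ = s ^ (-(1 / 2) : ℝ) * ((Real.sqrt α * r) * (M * K) * 1 +
        (H2 * K + M * H1) * s ^ (-(1 / 4) : ℝ) * r) := by rw [← e1]; ring
    _ ≤ s ^ (-(1 / 2) : ℝ) * ((Real.sqrt α * r) * (M * K) *
        (T ^ (1 / 4 : ℝ) * s ^ (-(1 / 4) : ℝ)) +
        (H2 * K + M * H1) * s ^ (-(1 / 4) : ℝ) * r) :=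
        mul_le_mul_of_nonneg_left (add_le_add (mul_le_mul_of_nonneg_left e3 hq) le_rfl) hs0
    _ = _ := by rw [e2]; ring

/-! ### A gradient bound independent of the truncation. -/

/-- The exponential rate in the gradient bound. -/
def gradRate (M : ℝ) : ℝ := (2 * ((∫ z, |gauss1 z|) * M * expBetaConst) + 1) ^ 2

/-- The constant in the gradient bound `|u_x| ≤ gradConst M T / √t` on `(0, T]`. -/
def gradConst (M T : ℝ) : ℝ := 2 * ((∫ z, |gauss1 z|) * M) * Real.exp (gradRate M * T)

lemma gradConst_nonneg (hM : 0 ≤ M) (T : ℝ) : 0 ≤ gradConst M T := by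
  have i1 : 0 ≤ ∫ z, |gauss1 z| := integral_nonneg fun _ => abs_nonneg _
  unfold gradConst
  positivity

/-- Singular Gronwall estimate for the gradient of a mild solution. -/
lemma sqrt_mul_abs_mildX_le_exp (hg : ∀ x, |g x| ≤ M) (hf : IsSource f A)
    (hfv : ∀ x s, 0 < s → |f x s| ≤ M * |mildX g f x s|) (x : ℝ) {t : ℝ} (ht : 0 < t) :
    Real.sqrt t * |mildX g f x t| ≤
      2 * ((∫ z, |gauss1 z|) * M) * Real.exp (gradRate M * t) := by
  have hM : 0 ≤ M := (abs_nonneg _).trans (hg 0)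
  have hA := hf.nonneg
  have i1 : 0 ≤ ∫ z, |gauss1 z| := integral_nonneg fun _ => abs_nonneg _
  have hκ := expBetaConst_nonneg
  have hB := betaInt_nonneg (1 / 2) (1 / 2)
  set c := (∫ z, |gauss1 z|) * M with hc
  have hc0 : 0 ≤ c := mul_nonneg i1 hM
  set lam := gradRate M with hlam
  have hl1 : 1 ≤ lam := by
    rw [hlam, gradRate]
    have : 0 ≤ c * expBetaConst := by positivity
    nlinarith
  have hl0 : 0 < lam := by linarith
  have hrate : c * ((Real.sqrt lam)⁻¹ * expBetaConst) ≤ 1 / 2 := by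
    have : 0 ≤ c * expBetaConst := by positivity
    rw [hlam, gradRate, Real.sqrt_sq (by positivity), mul_left_comm, ← hc, mul_comm,
      ← div_eq_mul_inv, div_le_iff₀ (by positivity)]
    linarith
  -- The bound improves itself: inserting it into `|f| ≤ M |u_x|` and then into the Duhamel integral
  -- maps `A₀` to `c + A₀/2`, because `hrate` makes the weighted Duhamel operator of norm at most
  -- 1/2.
  have step : ∀ A₀, 0 ≤ A₀ →
      (∀ x t, 0 < t → Real.sqrt t * |mildX g f x t| ≤ A₀ * Real.exp (lam * t)) →
      ∀ x t, 0 < t → Real.sqrt t * |mildX g f x t| ≤ (c + A₀ / 2) * Real.exp (lam * t) := by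
    intro A₀ hA₀ hyp x t ht
    have h1 := sqrt_mul_abs_mildX_le (f := f) hg x ht
    have h2 := IsSource.abs_duhamel_gauss1_le_exp (f := f) (x := x) (d := M * A₀) hl0
      (by positivity) ht (fun y s hs _ => by
        have h3 := hyp y s hs
        have hsq : 0 < Real.sqrt s := Real.sqrt_pos.2 hs
        refine (hfv y s hs).trans ?_
        rw [mul_assoc M, mul_assoc M]
        refine mul_le_mul_of_nonneg_left ?_ hM
        rw [Real.rpow_neg hs.le, ← Real.sqrt_eq_rpow, mul_right_comm, ← div_eq_mul_inv,
          le_div_iff₀ hsq, mul_comm]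
        exact h3)
    have he : 1 ≤ Real.exp (lam * t) := Real.one_le_exp (by positivity)
    have h3 : (∫ z, |gauss1 z|) * (M * A₀) * Real.exp (lam * t) *
        ((Real.sqrt lam)⁻¹ * expBetaConst) =
        (c * ((Real.sqrt lam)⁻¹ * expBetaConst)) * (A₀ * Real.exp (lam * t)) := by
      rw [hc]; ring
    rw [h3] at h2
    have h4 := mul_le_mul_of_nonneg_right hrate
      (mul_nonneg hA₀ (Real.exp_pos (lam * t)).le)
    have h5 : c ≤ c * Real.exp (lam * t) := le_mul_of_one_le_right hc0 he
    linarith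
  obtain ⟨A₀, hA₀, h0⟩ : ∃ A₀, 0 ≤ A₀ ∧ ∀ x t, 0 < t →
      Real.sqrt t * |mildX g f x t| ≤ (2 * c + A₀) * Real.exp (lam * t) := by
    -- The starting bound depends on the source constant `A`, hence on `K` in the application.
    -- Iteration halves this excess over the fixed point `2 c` and the limit removes it.
    refine ⟨(∫ z, |gauss1 z|) * A * betaInt (1 / 2) (1 / 2), by positivity, fun x t ht => ?_⟩
    refine (abs_mildX_le hg hf x ht).trans ?_
    have he : 1 ≤ Real.exp (lam * t) := Real.one_le_exp (by positivity)
    have he2 : Real.sqrt t ≤ Real.exp (lam * t) := by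
      have h1 := Real.add_one_le_exp (lam * t)
      have h2 : t ≤ lam * t := le_mul_of_one_le_left ht.le hl1
      have h3 : Real.sqrt t ≤ 1 + t := by
        rw [Real.sqrt_le_left (by positivity)]; nlinarith
      linarith
    have hq : 0 ≤ (∫ z, |gauss1 z|) * A * betaInt (1 / 2) (1 / 2) := by positivity
    nlinarith [mul_le_mul_of_nonneg_right he2 hq, mul_le_mul_of_nonneg_left he hc0]
  have iter : ∀ n : ℕ, ∀ x t, 0 < t → Real.sqrt t * |mildX g f x t| ≤
      (2 * c + A₀ * (1 / 2) ^ n) * Real.exp (lam * t) := by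
    intro n
    induction n with
    | zero => simpa using h0
    | succ n ih =>
      intro x t ht
      refine (step _ (by positivity) ih x t ht).trans (le_of_eq ?_)
      rw [pow_succ]; ring
  have hlim : Tendsto (fun n : ℕ => (2 * c + A₀ * (1 / 2) ^ n) * Real.exp (lam * t)) atTop
      (𝓝 ((2 * c + A₀ * 0) * Real.exp (lam * t))) :=
    (((tendsto_pow_atTop_nhds_zero_of_lt_one (by norm_num) (by norm_num)).const_mul
      A₀).const_add (2 * c)).mul_const _
  rw [mul_zero, add_zero] at hlim
  exact ge_of_tendsto' hlim fun n => iter n x t ht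

end regularity

/-! ### Solutions up to a finite time. -/

/-- `u` is a bounded classical solution on `ℝ × (0, T]` with initial data `g`. -/
structure IsSolutionUpTo (α : ℝ) (g : ℝ → ℝ) (T : ℝ) (u : ℝ → ℝ → ℝ) : Prop where
  bounded : ∃ C, ∀ x t, 0 < t → t ≤ T → |u x t| ≤ C
  regular : IsC21 u
  equation : ∀ x t, 0 < t → t ≤ T → dt u x t - dx (dx u) x t + h α x * u x t * dx u x t = 0
  initial : ∃ C t₀, 0 ≤ C ∧ 0 < t₀ ∧ ∀ x t, 0 < t → t < t₀ →
    |u x t - smooth gauss0 t g x| ≤ C * Real.sqrt t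

/-- Existence up to time `T`, with the maximum principle and the gradient bound. -/
lemma exists_solutionUpTo {α M : ℝ} (hα : 0 < α) {g : ℝ → ℝ} (hm : Measurable g)
    (hg : ∀ x, |g x| ≤ M) (T : ℝ) :
    ∃ u, IsSolutionUpTo α g T u ∧ (∀ x t, 0 < t → t ≤ T → |u x t| ≤ M) ∧
      ∀ x t, 0 < t → t ≤ T → |dx u x t| ≤ gradConst M T / Real.sqrt t := by
  have hM : 0 ≤ M := (abs_nonneg _).trans (hg 0)
  set K := gradConst M T with hKdef
  have hK : 0 ≤ K := gradConst_nonneg hM T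
  obtain ⟨f, hf, hfix⟩ := exists_truncated_source hα hK hm hg (M := M) (K := K)
  have hH := isHolderSource_truncated hα hK hm hg hf hfix
  obtain ⟨hreg, heq⟩ := isC21_mild hm hg hf hH
  -- Clamping does not increase absolute values, so this bound is free of `K`, as the Gronwall
  -- estimate needs.
  have hfv : ∀ x s, 0 < s → |f x s| ≤ M * |mildX g f x s| := by
    intro x s hs
    have hsq : 0 < Real.sqrt s := Real.sqrt_pos.2 hs
    have h1 := abs_h_le_one hα x
    have h2 := abs_clamp_le hM (mild g f x s)
    have h3 := abs_clamp_le_abs hK (Real.sqrt s * mildX g f x s)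
    rw [abs_mul, abs_of_pos hsq] at h3
    rw [hfix x s hs, truncated, Real.rpow_neg hs.le, ← Real.sqrt_eq_rpow, abs_mul, abs_mul,
      abs_mul, abs_of_pos (inv_pos.2 hsq)]
    calc _ ≤ (Real.sqrt s)⁻¹ * (1 * M * (Real.sqrt s * |mildX g f x s|)) := by gcongr
      _ = _ := by field_simp
  have hgrad : ∀ x t, 0 < t → t ≤ T → Real.sqrt t * |mildX g f x t| ≤ K := by
    intro x t ht htT
    refine (sqrt_mul_abs_mildX_le_exp hg hf hfv x ht).trans ?_
    have i1 : 0 ≤ ∫ z, |gauss1 z| := integral_nonneg fun _ => abs_nonneg _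
    have : 0 ≤ gradRate M := by unfold gradRate; positivity
    rw [hKdef, gradConst]
    gcongr
  -- By the choice of `K` the gradient clamp is inactive on `(0, T]`, whereas it may act at later
  -- times.
  have hfeq : ∀ x t, 0 < t → t ≤ T →
      f x t = h α x * clamp M (mild g f x t) * mildX g f x t := by
    intro x t ht htT
    have hsq : 0 < Real.sqrt t := Real.sqrt_pos.2 ht
    rw [hfix x t ht, truncated, clamp_eq_self (M := K), Real.rpow_neg ht.le, ← Real.sqrt_eq_rpow]
    · field_simp
    · rw [abs_mul, abs_of_pos hsq]; exact hgrad x t ht htT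
  set C := (∫ z, |gauss0 z|) * (M * K) * betaInt 0 (1 / 2) with hC
  have hC0 : 0 ≤ C := mul_nonneg (mul_nonneg (integral_nonneg fun _ => abs_nonneg _)
    hf.nonneg) (betaInt_nonneg _ _)
  have hini : ∀ x t, 0 < t → |mild g f x t - smooth gauss0 t g x| ≤ C * Real.sqrt t :=
    fun x t ht => abs_mild_sub_smooth_le hf x ht
  have hini' : ∀ x t, 0 < t → |mild g f x t| ≤ M + C * Real.sqrt t := by
    intro x t ht
    have h1 := abs_smooth_gauss0_le hg t x
    have h2 := abs_add_le (smooth gauss0 t g x) (mild g f x t - smooth gauss0 t g x)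
    rw [add_sub_cancel] at h2
    linarith [hini x t ht]
  have hbd : ∀ x t, 0 < t → t ≤ T → |mild g f x t| ≤ M := by
    intro x t ht htT
    -- With the clamp on `u` still in place the drift is bounded by `M`, so the maximum principle
    -- applies before `|u| ≤ M` is known; its conclusion then removes that clamp.
    refine abs_le_of_drift_equation (T := T) (B := M) (N := M + C * Real.sqrt T)
      (b := fun x t => -(h α x * clamp M (mild g f x t))) hreg ?_ ?_ ?_ hM hC0 ?_ ht htT
    · intro x t ht htT
      obtain ⟨h1, h2⟩ := heq x t ht
      rw [h2, h1, hfeq x t ht htT]; ring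
    · intro x t ht htT
      have h1 := abs_h_le_one hα x
      have h2 := abs_clamp_le hM (mild g f x t)
      rw [abs_neg, abs_mul]
      calc _ ≤ 1 * M := by gcongr
        _ = M := one_mul M
    · intro x t ht htT
      refine (hini' x t ht).trans ?_
      have := Real.sqrt_le_sqrt htT
      gcongr
    · exact fun x t ht _ => hini' x t ht
  refine ⟨mild g f, ⟨⟨M, hbd⟩, hreg, fun x t ht htT => ?_, ⟨C, 1, hC0, one_pos,
    fun x t ht _ => hini x t ht⟩⟩, hbd, fun x t ht htT => ?_⟩
  · obtain ⟨h1, h2⟩ := heq x t ht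
    rw [h2, h1, hfeq x t ht htT, clamp_eq_self (hbd x t ht htT)]; ring
  · rw [(heq x t ht).1, le_div_iff₀ (Real.sqrt_pos.2 ht), mul_comm]
    exact hgrad x t ht htT

namespace IsSolutionUpTo

variable {α : ℝ} {g : ℝ → ℝ} {u v : ℝ → ℝ → ℝ} {S T : ℝ}

lemma mono (hu : IsSolutionUpTo α g T u) (h : S ≤ T) : IsSolutionUpTo α g S u where
  bounded := hu.bounded.imp fun _ hC x t h0 h1 => hC x t h0 (h1.trans h)
  regular := hu.regular
  equation x t h0 h1 := hu.equation x t h0 (h1.trans h)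
  initial := hu.initial

/-- The heat flows of the data differ by at most `δ`, so the solutions differ initially by `δ +
O(√t)`, the input of the comparison estimate. -/
lemma abs_sub_le {g₁ g₂ : ℝ → ℝ} {A₁ A₂ δ L : ℝ} (hα : 0 < α)
    (hu : IsSolutionUpTo α g₁ T u) (hv : IsSolutionUpTo α g₂ T v)
    (hm₁ : Measurable g₁) (hg₁ : ∀ x, |g₁ x| ≤ A₁) (hm₂ : Measurable g₂) (hg₂ : ∀ x, |g₂ x| ≤ A₂)
    (hδ : ∀ x, |g₁ x - g₂ x| ≤ δ) (hL : 0 ≤ L)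
    (hgrad : ∀ x t, 0 < t → t ≤ T → |dx u x t| ≤ L / Real.sqrt t)
    {x t : ℝ} (ht : 0 < t) (htT : t ≤ T) :
    |u x t - v x t| ≤ δ * Real.exp (2 * L * Real.sqrt t) := by
  have hδ0 : 0 ≤ δ := (abs_nonneg _).trans (hδ 0)
  obtain ⟨B, hB⟩ := hu.bounded
  obtain ⟨N, hN⟩ := hv.bounded
  obtain ⟨C₁, t₁, hC₁, ht₁, hi₁⟩ := hu.initial
  obtain ⟨C₂, t₂, hC₂, ht₂, hi₂⟩ := hv.initial
  refine abs_sub_le_of_gradient_bound hα hu.regular hv.regular hu.equation hv.equation hB hN hgrad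
    hL hδ0 (add_nonneg hC₁ hC₂) (lt_min ht₁ ht₂) (fun x t h0 h1 => ?_) ht htT
  have a1 := abs_le.1 (hi₁ x t h0 (h1.trans_le (min_le_left _ _)))
  have a2 := abs_le.1 (hi₂ x t h0 (h1.trans_le (min_le_right _ _)))
  have a3 := abs_smooth_gauss0_le hδ t x
  rw [smooth_sub gaussBound0 hm₁ hg₁ hm₂ hg₂] at a3
  have a4 := abs_le.1 a3
  rw [add_mul]
  exact abs_le.2 ⟨by linarith, by linarith⟩

lemma eq_of_gradient_bound {A L : ℝ} (hα : 0 < α)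
    (hu : IsSolutionUpTo α g T u) (hv : IsSolutionUpTo α g T v)
    (hm : Measurable g) (hg : ∀ x, |g x| ≤ A) (hL : 0 ≤ L)
    (hgrad : ∀ x t, 0 < t → t ≤ T → |dx u x t| ≤ L / Real.sqrt t)
    {x t : ℝ} (ht : 0 < t) (htT : t ≤ T) : u x t = v x t := by
  have := hu.abs_sub_le hα hv hm hg hm hg (δ := 0) (fun x => by simp) hL hgrad (x := x) ht htT
  rw [zero_mul] at this
  exact sub_eq_zero.1 (abs_nonpos_iff.1 this)

end IsSolutionUpTo

/-! ### Gluing in time. -/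

lemma eventuallyEq_time {u v : ℝ → ℝ → ℝ} {T : ℝ} (h : ∀ x t, 0 < t → t ≤ T → u x t = v x t)
    (x : ℝ) {t : ℝ} (ht : 0 < t) (htT : t < T) : (fun s => u x s) =ᶠ[𝓝 t] fun s => v x s := by
  filter_upwards [Ioo_mem_nhds ht htT] with s hs using h x s hs.1 hs.2.le

/-- Being `C^{2,1}` is local in time. -/
lemma isC21_of_local {u : ℝ → ℝ → ℝ} (U : ℝ → ℝ → ℝ → ℝ) (hU : ∀ T, IsC21 (U T))
    (h : ∀ T x t, 0 < t → t ≤ T → u x t = U T x t) :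
    IsC21 u ∧ ∀ T x t, 0 < t → t < T → dx u x t = dx (U T) x t ∧
      dx (dx u) x t = dx (dx (U T)) x t ∧ dt u x t = dt (U T) x t := by
  have e0 : ∀ T t, 0 < t → t < T → (fun y => u y t) = fun y => U T y t :=
    fun T t h0 h1 => funext fun y => h T y t h0 h1.le
  have e1 : ∀ T x t, 0 < t → t < T → dx u x t = dx (U T) x t := by
    intro T x t h0 h1
    rw [dx, e0 T t h0 h1, dx]
  have e1' : ∀ T t, 0 < t → t < T → (fun y => dx u y t) = fun y => dx (U T) y t :=
    fun T t h0 h1 => funext fun y => e1 T y t h0 h1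
  have e2 : ∀ T x t, 0 < t → t < T → dx (dx u) x t = dx (dx (U T)) x t := by
    intro T x t h0 h1
    rw [dx, e1' T t h0 h1, ← dx]
  have e3 : ∀ T x t, 0 < t → t < T → dt u x t = dt (U T) x t := by
    intro T x t h0 h1
    exact (eventuallyEq_time (h T) x h0 h1).deriv_eq
  have hloc : ∀ F : ℝ × ℝ → ℝ, ∀ G : ℝ → ℝ × ℝ → ℝ, (∀ T, ContinuousOn (G T) domain) →
      (∀ T x t, 0 < t → t < T → F (x, t) = G T (x, t)) → ContinuousOn F domain := by
    rintro F G hG hFG ⟨x, t⟩ hp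
    have ht : 0 < t := mem_domain.1 hp
    have hev : F =ᶠ[𝓝 (x, t)] G (t + 1) := by
      filter_upwards [isOpen_domain.mem_nhds hp, continuous_snd.continuousAt.eventually
        (gt_mem_nhds (show (x, t).2 < t + 1 by simp))] with q hq hq'
      exact hFG (t + 1) q.1 q.2 hq.2 hq'
    exact (((hG (t + 1)).continuousAt (isOpen_domain.mem_nhds hp)).congr
      hev.symm).continuousWithinAt
  refine ⟨⟨fun x t ht => ?_, fun x t ht => ?_, fun x t ht => ?_, ?_, ?_, ?_, ?_⟩,
    fun T x t h0 h1 => ⟨e1 T x t h0 h1, e2 T x t h0 h1, e3 T x t h0 h1⟩⟩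
  · rw [e0 (t + 1) t ht (lt_add_one t)]
    exact (hU (t + 1)).diff_x x t ht
  · rw [e1' (t + 1) t ht (lt_add_one t)]
    exact (hU (t + 1)).diff_xx x t ht
  · exact ((hU (t + 1)).diff_t x t ht).congr_of_eventuallyEq
      (eventuallyEq_time (h (t + 1)) x ht (lt_add_one t))
  · exact hloc _ (fun T p => U T p.1 p.2) (fun T => (hU T).cont)
      fun T x t h0 h1 => h T x t h0 h1.le
  · exact hloc _ (fun T p => dx (U T) p.1 p.2) (fun T => (hU T).cont_x) e1
  · exact hloc _ (fun T p => dx (dx (U T)) p.1 p.2) (fun T => (hU T).cont_xx) e2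
  · exact hloc _ (fun T p => dt (U T) p.1 p.2) (fun T => (hU T).cont_t) e3

/-- Global existence, with the maximum principle and the gradient bound. -/
lemma exists_global_solution {α M : ℝ} (hα : 0 < α) {g : ℝ → ℝ} (hm : Measurable g)
    (hg : ∀ x, |g x| ≤ M) :
    ∃ u, (∀ T, IsSolutionUpTo α g T u) ∧ (∀ x t, 0 < t → |u x t| ≤ M) ∧
      ∀ T x t, 0 < t → t ≤ T → |dx u x t| ≤ gradConst M (T + 1) / Real.sqrt t := by
  have hM : 0 ≤ M := (abs_nonneg _).trans (hg 0)
  choose U hU hUM hUg using fun T => exists_solutionUpTo hα hm hg T (M := M)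
  -- The global solution at time `t` is read off from `U (t + 1)`. The margin 1 leaves room for a
  -- neighbourhood of `t`, which the time derivative needs.
  have agree : ∀ T x t, 0 < t → t ≤ T → U (t + 1) x t = U T x t := by
    intro T x t ht htT
    have ht1 : t ≤ t + 1 := by linarith
    exact ((hU (t + 1)).mono ht1).eq_of_gradient_bound hα ((hU T).mono htT) hm hg
      (gradConst_nonneg hM (t + 1)) (fun x s h0 h1 => hUg (t + 1) x s h0 (h1.trans ht1)) ht le_rfl
  obtain ⟨hreg, hder⟩ := isC21_of_local (u := fun x t => U (t + 1) x t) U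
    (fun T => (hU T).regular) agree
  refine ⟨fun x t => U (t + 1) x t, fun T => ⟨⟨M, fun x t h0 _ => hUM (t + 1) x t h0
    (by linarith)⟩, hreg, fun x t h0 _ => ?_, ?_⟩, fun x t h0 => hUM (t + 1) x t h0 (by linarith),
    fun T x t h0 h1 => ?_⟩
  · obtain ⟨d1, d2, d3⟩ := hder (t + 1) x t h0 (lt_add_one t)
    rw [d1, d2, d3]
    exact (hU (t + 1)).equation x t h0 (by linarith)
  · obtain ⟨C, t₀, hC, ht₀, hi⟩ := (hU 1).initial
    refine ⟨C, min t₀ 1, hC, lt_min ht₀ one_pos, fun x t h0 h1 => ?_⟩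
    simp only [agree 1 x t h0 (h1.le.trans (min_le_right _ _))]
    exact hi x t h0 (h1.trans_le (min_le_left _ _))
  -- Derivatives are compared only at times strictly below the index, hence `T + 1` in the gradient
  -- constant.
  · rw [(hder (T + 1) x t h0 (by linarith)).1]
    exact hUg (T + 1) x t h0 (by linarith)

/-! ### Passage from essentially bounded data to bounded representatives. -/

lemma heatFlow_congr_ae {u₀ g : ℝ → ℝ} (h : u₀ =ᵐ[volume] g) (x : ℝ) {t : ℝ} (ht : 0 < t) :
    heatFlow u₀ x t = smooth gauss0 t g x := by
  rw [← heatFlow_eq_smooth g x ht, heatFlow, heatFlow]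
  refine integral_congr_ae ?_
  filter_upwards [h] with s hs
  rw [hs]

/-- The data enter only through the heat flow, which ignores null sets. -/
lemma isGlobalSolution_iff {α : ℝ} {u₀ g : ℝ → ℝ} (h : u₀ =ᵐ[volume] g) {u : ℝ → ℝ → ℝ} :
    IsGlobalSolution α u₀ u ↔ ∀ T, IsSolutionUpTo α g T u := by
  constructor
  · intro hu T
    refine ⟨?_, hu.regular, fun x t h0 _ => hu.equation x t h0, ?_⟩
    · obtain ⟨C, hC⟩ := hu.bounded (max T 1) (lt_max_of_lt_right one_pos)
      exact ⟨C, fun x t h0 h1 => hC x t h0 (h1.trans (le_max_left _ _))⟩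
    · obtain ⟨C, t₀, ht₀, hi⟩ := hu.initial
      refine ⟨max C 0, t₀, le_max_right _ _, ht₀, fun x t h0 h1 => ?_⟩
      rw [← heatFlow_congr_ae h x h0]
      exact (hi x t h0 h1).trans
        (mul_le_mul_of_nonneg_right (le_max_left _ _) (Real.sqrt_nonneg t))
  · intro hu
    refine ⟨fun T _ => (hu T).bounded, (hu 0).regular,
      fun x t h0 => (hu t).equation x t h0 le_rfl, ?_⟩
    obtain ⟨C, t₀, -, ht₀, hi⟩ := (hu 0).initial
    refine ⟨C, t₀, ht₀, fun x t h0 h1 => ?_⟩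
    rw [heatFlow_congr_ae h x h0]
    exact hi x t h0 h1

/-- An essentially bounded function has a measurable representative bounded everywhere. -/
lemma exists_bounded_representative {u₀ : ℝ → ℝ} (hu : AEStronglyMeasurable u₀ volume) {M : ℝ}
    (hM : 0 ≤ M) (h : eLpNorm u₀ ⊤ volume ≤ ENNReal.ofReal M) :
    ∃ g, Measurable g ∧ (∀ x, |g x| ≤ M) ∧ u₀ =ᵐ[volume] g := by
  refine ⟨fun x => clamp M (hu.mk u₀ x),
    (continuous_clamp M).measurable.comp hu.stronglyMeasurable_mk.measurable,
    fun x => abs_clamp_le hM _, ?_⟩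
  rw [eLpNorm_exponent_top] at h
  filter_upwards [hu.ae_eq_mk, ae_le_eLpNormEssSup (f := u₀) (μ := volume)] with x h1 h2
  rw [← h1, clamp_eq_self]
  have h3 := h2.trans h
  rw [← ofReal_norm, ENNReal.ofReal_le_ofReal_iff hM, Real.norm_eq_abs] at h3
  exact h3

end GenBurgers

end

theorem theorem1 (α : ℝ) (hα : 0 < α) :
    (∀ u₀ : ℝ → ℝ, MemLp u₀ ⊤ volume →
      ∃ u : ℝ → ℝ → ℝ,
        GenBurgers.IsGlobalSolution α u₀ u ∧
        (∃ C : ℝ, ∀ x t : ℝ, 0 < t → |u x t| ≤ C) ∧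
        ∀ v : ℝ → ℝ → ℝ, GenBurgers.IsGlobalSolution α u₀ v →
          ∀ x t : ℝ, 0 < t → v x t = u x t) ∧
    (∀ T ε M : ℝ, 0 < T → 0 < ε → 0 ≤ M →
      ∃ δ : ℝ, 0 < δ ∧
        ∀ u₀₁ u₀₂ : ℝ → ℝ, MemLp u₀₁ ⊤ volume → MemLp u₀₂ ⊤ volume →
          eLpNorm u₀₁ ⊤ volume ≤ ENNReal.ofReal M →
          eLpNorm (fun x => u₀₁ x - u₀₂ x) ⊤ volume < ENNReal.ofReal δ →
          ∀ u₁ u₂ : ℝ → ℝ → ℝ,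
            GenBurgers.IsGlobalSolution α u₀₁ u₁ → GenBurgers.IsGlobalSolution α u₀₂ u₂ →
            ∀ t : ℝ, 0 < t → t ≤ T →
              eLpNorm (fun x => u₁ x t - u₂ x t) ⊤ volume < ENNReal.ofReal ε) := by
  open GenBurgers in
  constructor
  · intro u₀ hu₀
    obtain ⟨g, hm, hg, hae⟩ := exists_bounded_representative hu₀.1
      (M := (eLpNorm u₀ ⊤ volume).toReal) ENNReal.toReal_nonneg
      (ENNReal.ofReal_toReal hu₀.2.ne).ge
    obtain ⟨u, hu, hb, hgrad⟩ := exists_global_solution hα hm hg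
    refine ⟨u, (isGlobalSolution_iff hae).2 hu, ⟨_, hb⟩, fun v hv x t ht => ?_⟩
    exact ((hu t).eq_of_gradient_bound hα ((isGlobalSolution_iff hae).1 hv t) hm hg
      (gradConst_nonneg ENNReal.toReal_nonneg _) (hgrad t) ht le_rfl).symm
  · intro T ε M hT hε hM
    have hE := Real.exp_pos (2 * gradConst M (T + 1) * Real.sqrt T)
    -- Inverts the growth factor of the stability estimate at time `T`. The half keeps the
    -- inequality strict after taking the essential supremum.
    refine ⟨ε / 2 / Real.exp (2 * gradConst M (T + 1) * Real.sqrt T), by positivity, ?_⟩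
    intro u₀₁ u₀₂ h₁ h₂ hM₁ hδ u₁ u₂ hu₁ hu₂ t ht htT
    set δ := ε / 2 / Real.exp (2 * gradConst M (T + 1) * Real.sqrt T) with hδd
    have hδ0 : 0 ≤ δ := by positivity
    obtain ⟨g, hm, hg, hae⟩ := exists_bounded_representative h₁.1 hM hM₁
    obtain ⟨g', hm', hg', hae'⟩ := exists_bounded_representative (h₁.1.sub h₂.1) hδ0 hδ.le
    -- Representing the second datum as `g - g'` makes the difference of the representatives equal
    -- to `g'`, bounded by `δ` everywhere and not just almost everywhere.
    have hae₂ : u₀₂ =ᵐ[volume] fun x => g x - g' x := by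
      filter_upwards [hae, hae'] with x e1 e2
      rw [← e1, ← e2, Pi.sub_apply, sub_sub_cancel]
    have hg₂ : ∀ x, |g x - g' x| ≤ M + δ := fun x =>
      (abs_sub _ _).trans (add_le_add (hg x) (hg' x))
    obtain ⟨u, hu, hb, hgrad⟩ := exists_global_solution hα hm hg
    have hL := gradConst_nonneg hM (T + 1)
    have hv₁ := (isGlobalSolution_iff hae).1 hu₁ T
    have hv₂ := (isGlobalSolution_iff hae₂).1 hu₂ T
    have key : ∀ x, ‖u₁ x t - u₂ x t‖ ≤ ε / 2 := by
      intro x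
      -- By uniqueness `u₁` is the constructed solution, which carries the gradient bound; no such
      -- bound is needed for `u₂`.
      rw [← (hu T).eq_of_gradient_bound hα hv₁ hm hg hL (hgrad T) ht htT, Real.norm_eq_abs]
      refine ((hu T).abs_sub_le hα hv₂ hm hg (hm.sub hm') hg₂ (δ := δ)
        (fun x => by simpa using hg' x) hL (hgrad T) ht htT).trans ?_
      have h3 : Real.exp (2 * gradConst M (T + 1) * Real.sqrt t) ≤
          Real.exp (2 * gradConst M (T + 1) * Real.sqrt T) := by
        have := Real.sqrt_le_sqrt htT
        gcongr
      calc _ ≤ δ * Real.exp (2 * gradConst M (T + 1) * Real.sqrt T) :=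
            mul_le_mul_of_nonneg_left h3 hδ0
        _ = ε / 2 := by rw [hδd]; field_simp
    rw [eLpNorm_exponent_top]
    refine (eLpNormEssSup_le_of_ae_bound (Filter.Eventually.of_forall key)).trans_lt ?_
    exact (ENNReal.ofReal_lt_ofReal_iff hε).2 (by linarith)
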